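/- **Setting.** Let $\mathcal B_n=\{\pm1\}^n\rtimes\mathfrak S_n$ be the hyperoctahedral group, $t_i\in\{\pm1\}^n$ the sign change in coordinate $i$, $\varepsilon':\mathcal B_n\to\{\pm1\}$ the character with $\varepsilon'(t_i)=-1$ and $\varepsilon'|_{\mathfrak S_n}=1$, and $\mathcal D_n=\ker\varepsilon'$. The reflections of $\mathcal D_n$ are $(i,j)$ and $t_it_j(i,j)$ for $i<j$; those of $\mathcal B_n$ are these together with $t_1,\dots,t_n$. Let $\mathfrak b_n\subseteq \mathrm{Lie}(\mathbb C\mathcal B_n)$ and $\mathfrak d_n\subseteq\mathrm{Lie}(\mathbb C\mathcal D_n)$ be the Lie algebras (under the commutator) generated by the reflections, and $\mathfrak b_n'=[\mathfrak b_n,\mathfrak b_n]$, $\mathfrak d_n'=[\mathfrak d_n,\mathfrak d_n]$. For a bipartition $(\lambda,\mu)$ with $|\lambda|+|\mu|=n$ let $\mathbb T(\lambda,\mu)$ be the set of standard bitableaux $T=(T_+,T_-)$ of shape $(\lambda,\mu)$ with entries $1,\dots,n$. The simple module $S^{(\lambda,\mu)}$ of $\mathbb C\mathcal B_n$ has a basis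 $\{c_T : T\in\mathbb T(\lambda,\mu)\}$ (Young's orthogonal form) such that $t_i c_T=c_T$ if $i$ is in $T_+$ and $t_ic_T=-c_T$ if $i$ is in $T_-$, and such that $s=(i,i+1)$ acts by $$s\,c_T=d\,c_T+\sqrt{1-d^2}\;c_{sT},$$ where $d=0$ if $i$ and $i+1$ are in different tableaux of $T$, and otherwise $d=1/(\mathrm{res}_T(i+1)-\mathrm{res}_T(i))$, the residue of a box being its column minus its row (the second term is $0$ when $sT$ is not standard, since then $d=\pm1$). Let $\rho_{(\lambda,\mu)}:\mathbb C\mathcal B_n\to\mathrm{End}(S^{(\lambda,\mu)})$ be the structure map and $\langle-,-\rangle$ the bilinear form on $S^{(\lambda,\mu)}$ for which $\{c_T\}$ is orthonormal. Let $S^{\{\lambda,\mu\}}$, with structure map $\rho_{\{\lambda,\mu\}}$, be the restriction of $S^{(\lambda,\mu)}$ to $\mathcal D_n$, and let $S^{\{\lambda,\pm\}}$, with structure map $\rho_{\{\lambda,\pm\}}$, be the $\mathbb C\mathcal D_n$-submodule of $S^{\{\lambda,\lambda\}}$ spanned by the vectors $c_T\pm c_{T^\natural}$, where $T^\natural=(T_-,T_+)$.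 Put $$\mathfrak b_{(\lambda,\mu)}=\rho_{(\lambda,\mu)}(\mathfrak b_n'),\qquad \mathfrak d_{\{\lambda,\mu\}}=\rho_{\{\lambda,\mu\}}(\mathfrak d_n'),\qquad \mathfrak d_{\{\lambda,\pm\}}=\rho_{\{\lambda,\pm\}}(\mathfrak d_n').$$ Let $\lambda^*$ be the conjugate partition, $T^*=(T_+^*,T_-^*)$ the bitableau with both tableaux transposed, and $\ell(T)$ the Coxeter length of the permutation $\sigma_T\in\mathfrak S_n$ with $\sigma_T\cdot R=T$, where $R$ is the row-major bitableau of shape $(\lambda,\mu)$ (first tableau first). Let $$\phi_{\varepsilon'}:S^{(\lambda,\mu)}\to S^{(\mu,\lambda)},\ c_T\mapsto c_{T^\natural},\qquad \phi_{\varepsilon''}:S^{(\lambda,\mu)}\to S^{(\lambda^*,\mu^*)},\ c_T\mapsto(-1)^{\ell(T)}c_{T^*},\qquad \phi_\varepsilon=\phi_{\varepsilon''}\circ\phi_{\varepsilon'}.$$ For a bilinear form $(-|-)$ on $V$ write $\mathfrak{osp}(V)=\{x\in\mathfrak{gl}(V):(xu|v)+(u|xv)=0\text{ for all }u,v\in V\}$;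 if the form is nondegenerate, this is $\mathfrak{so}(V)$ when the form is symmetric and $\mathfrak{sp}(V)$ when it is anti-symmetric. Let $b(\lambda)$ be the length of the diagonal of the Young diagram of $\lambda$. **Lemma.** 1. Let $|\lambda|+|\mu|=n$ and $(\lambda,\mu)=(\mu^*,\lambda^*)$, and let $(u|v)=\langle u,\phi_\varepsilon(v)\rangle$ on $S^{(\lambda,\mu)}$. This form is nondegenerate and $\mathfrak b_{(\lambda,\mu)}\subseteq\mathfrak{osp}(S^{(\lambda,\mu)})$. The integer $n$ is even; the form is symmetric if $n/2$ is even and anti-symmetric if $n/2$ is odd. Thus $\mathfrak b_{(\lambda,\mu)}\subseteq\mathfrak{so}(S^{(\lambda,\mu)})$ if $n/2$ is even, and $\mathfrak b_{(\lambda,\mu)}\subseteq\mathfrak{sp}(S^{(\lambda,\mu)})$ if $n/2$ is odd. Moreover $\mathfrak d_{\{\lambda,\mu\}}\subseteq\mathfrak b_{(\lambda,\mu)}$, and so $\mathfrak d_{\{\lambda,\mu\}}\subseteq\mathfrak{osp}(S^{(\lambda,\mu)})$. 2. Let $|\lambda|+|\mu|=n$ and $(\lambda,\mu)=(\lambda^*,\mu^*)$,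 and let $(u|v)=\langle u,\phi_{\varepsilon''}(v)\rangle$ on $S^{\{\lambda,\mu\}}$. This form is nondegenerate and $\mathfrak d_{\{\lambda,\mu\}}\subseteq\mathfrak{osp}(S^{\{\lambda,\mu\}})$. The integer $n-b(\lambda)-b(\mu)$ is nonnegative and even; the form is symmetric if $\frac{n-b(\lambda)-b(\mu)}2$ is even and anti-symmetric if it is odd. Thus $\mathfrak d_{\{\lambda,\mu\}}\subseteq\mathfrak{so}(S^{\{\lambda,\mu\}})$ in the first case and $\mathfrak d_{\{\lambda,\mu\}}\subseteq\mathfrak{sp}(S^{\{\lambda,\mu\}})$ in the second. 3. Let $2|\lambda|=n$, $\lambda=\lambda^*$ and $n/2$ even. For either choice of sign, the restriction to $S^{\{\lambda,\pm\}}$ of the form of part 2 on $S^{\{\lambda,\lambda\}}$ is nondegenerate, and with respect to it $\mathfrak d_{\{\lambda,\pm\}}\subseteq\mathfrak{osp}(S^{\{\lambda,\pm\}})$. It is symmetric if $b(\lambda)$ is even and anti-symmetric if $b(\lambda)$ is odd. Thus $\mathfrak d_{\{\lambda,\pm\}}\subseteq\mathfrak{so}(S^{\{\lambda,\pm\}})$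 in the first case and $\mathfrak d_{\{\lambda,\pm\}}\subseteq\mathfrak{sp}(S^{\{\lambda,\pm\}})$ in the second. -/

import Mathlib

attribute [local instance] LieRing.ofAssociativeRing

noncomputable section

namespace WeylLie

open Equiv

/-! ## Boxes, bitableaux -/

/-- The boxes of the bipartition `(l, m)`: triples `(component, row, column)`, where the component
`false` stands for the first diagram `l` (subscript `+1`) and the component `true` for the second
diagram `m` (subscript `-1`).  Rows and columns are numbered from `0`. -/
def Cell (l m : YoungDiagram) : Type :=
  {p : Bool × ℕ × ℕ // p.2 ∈ (bif p.1 then m else l)}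

namespace Cell

variable {l m : YoungDiagram}

def comp (p : Cell l m) : Bool := p.1.1
def row (p : Cell l m) : ℕ := p.1.2.1
def col (p : Cell l m) : ℕ := p.1.2.2

/-- The residue (content) of a box. -/
def res (p : Cell l m) : ℤ := (p.col : ℤ) - (p.row : ℤ)

theorem ext' {p q : Cell l m} (h : p.comp = q.comp) (hr : p.row = q.row) (hc : p.col = q.col) :
    p = q := Subtype.ext (Prod.ext h (Prod.ext hr hc))

instance instFinite : Finite (Cell l m) := by
  refine Set.Finite.to_subtype
    (s := {p : Bool × ℕ × ℕ | p.2 ∈ (bif p.1 then m else l)}) ?_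
  refine (((Set.finite_univ (α := Bool)).prod (l.cells ∪ m.cells).finite_toSet)).subset ?_
  rintro ⟨b, p⟩ h
  cases b
  · simpa using Or.inl h
  · simpa using Or.inr h

/-- Exchanging the two diagrams. -/
def swapEquiv (l m : YoungDiagram) : Cell l m ≃ Cell m l where
  toFun p := ⟨(!p.1.1, p.1.2), by obtain ⟨⟨b, p⟩, h⟩ := p; cases b <;> simpa using h⟩
  invFun p := ⟨(!p.1.1, p.1.2), by obtain ⟨⟨b, p⟩, h⟩ := p; cases b <;> simpa using h⟩
  left_inv p := by apply Subtype.ext; simp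
  right_inv p := by apply Subtype.ext; simp

/-- Transposing both diagrams. -/
def transposeEquiv (l m : YoungDiagram) : Cell l m ≃ Cell l.transpose m.transpose where
  toFun p := ⟨(p.1.1, p.1.2.swap), by
    obtain ⟨⟨b, p⟩, h⟩ := p; cases b <;> simpa [YoungDiagram.mem_transpose] using h⟩
  invFun p := ⟨(p.1.1, p.1.2.swap), by
    obtain ⟨⟨b, p⟩, h⟩ := p; cases b <;> simpa [YoungDiagram.mem_transpose] using h⟩
  left_inv p := by apply Subtype.ext; simp
  right_inv p := by apply Subtype.ext; simp

/-- Transport along equalities of diagrams; the underlying triple does not change. -/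
def congrEquiv {l m l' m' : YoungDiagram} (hl : l = l') (hm : m = m') : Cell l m ≃ Cell l' m' :=
  Equiv.subtypeEquivRight fun p => by rw [hl, hm]

/-- The row-reading order on the boxes: first diagram before second, then by row, then by column. -/
instance instLinearOrder : LinearOrder (Cell l m) :=
  LinearOrder.lift' (fun p => toLex (p.1.1, toLex p.1.2) : Cell l m → Bool ×ₗ (ℕ ×ₗ ℕ))
    fun p q h => by
      have h1 := congrArg ofLex h
      have h2 := congrArg Prod.fst h1
      have h3 := congrArg (fun x : Bool × (ℕ ×ₗ ℕ) => ofLex x.2) h1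
      exact Subtype.ext (Prod.ext h2 h3)

end Cell

variable {n : ℕ} {l m : YoungDiagram}

/-- A filling of the boxes of `(l, m)` by the numbers `0, …, n - 1` is standard if its entries
increase along the rows and along the columns of both diagrams. -/
def IsStandard (f : Cell l m ≃ Fin n) : Prop :=
  (∀ p q : Cell l m, p.comp = q.comp → p.row = q.row → p.col < q.col → f p < f q) ∧
  (∀ p q : Cell l m, p.comp = q.comp → p.col = q.col → p.row < q.row → f p < f q)

/-- Standard bitableaux of shape `(l, m)`, with entries `Fin n` instead of `1, …, n`. -/
@[ext]
structure StdBitableau (n : ℕ) (l m : YoungDiagram) : Type where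
  filling : Cell l m ≃ Fin n
  standard : IsStandard filling

instance : Finite (StdBitableau n l m) :=
  Finite.of_injective StdBitableau.filling fun _ _ h => StdBitableau.ext h
instance : Fintype (StdBitableau n l m) := Fintype.ofFinite _
instance : DecidableEq (StdBitableau n l m) := Classical.decEq _

namespace StdBitableau

/-- `T ↦ T^♮`: exchange the two tableaux. -/
def natural (T : StdBitableau n l m) : StdBitableau n m l :=
  ⟨(Cell.swapEquiv l m).symm.trans T.filling,
    fun _ _ h hr hc => T.standard.1 _ _ (congrArg (fun b => !b) h) hr hc,
    fun _ _ h hc hr => T.standard.2 _ _ (congrArg (fun b => !b) h) hc hr⟩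

/-- `T ↦ T^*`: transpose both tableaux. -/
def transpose (T : StdBitableau n l m) : StdBitableau n l.transpose m.transpose :=
  ⟨(Cell.transposeEquiv l m).symm.trans T.filling,
    fun _ _ h hr hc => T.standard.2 _ _ h hr hc,
    fun _ _ h hc hr => T.standard.1 _ _ h hc hr⟩

/-- Transport along equalities of diagrams. -/
def congrShape {l' m' : YoungDiagram} (hl : l = l') (hm : m = m') (T : StdBitableau n l m) :
    StdBitableau n l' m' :=
  ⟨(Cell.congrEquiv hl hm).symm.trans T.filling,
    fun _ _ h hr hc => T.standard.1 _ _ h hr hc,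
    fun _ _ h hc hr => T.standard.2 _ _ h hc hr⟩

theorem card_cell (T : StdBitableau n l m) :
    @Fintype.card (Cell l m) (Fintype.ofFinite _) = n := by
  let := Fintype.ofFinite (Cell l m)
  simpa using Fintype.card_congr T.filling

/-- The row major filling `R` of the shape of `T`. -/
def rowMajor (T : StdBitableau n l m) : Cell l m ≃ Fin n :=
  letI := Fintype.ofFinite (Cell l m)
  (Fintype.orderIsoFinOfCardEq (Cell l m) T.card_cell).symm.toEquiv

/-- The permutation `σ_T` with `σ_T · R = T`. -/
def perm (T : StdBitableau n l m) : Perm (Fin n) := T.rowMajor.symm.trans T.filling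

/-- `(-1)^{ℓ(T)}`, where `ℓ(T)` is the Coxeter length of `σ_T`; it is the sign of `σ_T`. -/
def lengthSign (T : StdBitableau n l m) : ℂ := ((Perm.sign T.perm : ℤ) : ℂ)

end StdBitableau

/-! ## The groups of type B and D -/

/-- `σ` acts on `{±1}^n` by permuting the coordinates, `(σ · x)_i = x_{σ⁻¹ i}`. -/
def permAct (n : ℕ) : Perm (Fin n) →* MulAut (Fin n → ℤˣ) where
  toFun σ :=
    { toFun := fun x i => x (σ⁻¹ i)
      invFun := fun x i => x (σ i)
      left_inv := fun x => by funext i; simp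
      right_inv := fun x => by funext i; simp
      map_mul' := fun _ _ => rfl }
  map_one' := rfl
  map_mul' σ τ := by
    apply MulEquiv.ext; intro x; funext i
    simp [mul_inv_rev]

/-- The hyperoctahedral group `{±1}^n ⋊ 𝔖_n` of signed permutations. -/
abbrev BGroup (n : ℕ) : Type := (Fin n → ℤˣ) ⋊[permAct n] Perm (Fin n)

namespace BGroup

/-- The sign change `t_i`. -/
def t (i : Fin n) : BGroup n := SemidirectProduct.inl (Pi.mulSingle i (-1))

/-- A permutation as a signed permutation. -/
def ofPerm (σ : Perm (Fin n)) : BGroup n := SemidirectProduct.inr σ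

/-- The character `ε'`, with `ε'(t_i) = -1` and `ε'(σ) = 1` for permutations `σ`. -/
def epsilon' (n : ℕ) : BGroup n →* ℤˣ where
  toFun g := ∏ i, g.left i
  map_one' := by simp
  map_mul' g h := by
    have : ∏ i, h.left (g.right⁻¹ i) = ∏ i, h.left i := Equiv.prod_comp g.right⁻¹ h.left
    simp only [SemidirectProduct.mul_left, Pi.mul_apply, Finset.prod_mul_distrib]
    rw [← this]
    rfl

end BGroup

/-- The group of even-signed permutations, `𝓓_n = ker ε'`. -/
abbrev DGroup (n : ℕ) : Subgroup (BGroup n) := (BGroup.epsilon' n).ker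

/-- The reflections `(i,j)` and `t_i t_j (i,j)`, `i < j`. -/
def dReflections (n : ℕ) : Set (BGroup n) :=
  {g | ∃ i j : Fin n, i < j ∧
    (g = BGroup.ofPerm (swap i j) ∨ g = BGroup.t i * BGroup.t j * BGroup.ofPerm (swap i j))}

/-- The reflections of type B: those of type D together with the `t_i`. -/
def bReflections (n : ℕ) : Set (BGroup n) := dReflections n ∪ Set.range BGroup.t

/-! ## The modules `S^{(l,m)}`

The simple module labelled by `(l, m)` is realised by Young's orthogonal form: it has a basis `c_T`
indexed by the standard bitableaux, `t_i` acts on `c_T` by the sign of the tableau that contains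
`i`, and the adjacent transpositions act by explicit symmetric `2 × 2` blocks. -/

/-- The underlying space of `S^{(l,m)}`. -/
abbrev S (n : ℕ) (l m : YoungDiagram) : Type := StdBitableau n l m → ℂ

/-- The basis `c_T`. -/
abbrev c (n : ℕ) (l m : YoungDiagram) : Module.Basis (StdBitableau n l m) ℂ (S n l m) :=
  Pi.basisFun ℂ _

open Classical in
/-- `c_f` for an arbitrary filling `f`, understood as `0` if `f` is not standard. -/
def cFill (f : Cell l m ≃ Fin n) : S n l m := if h : IsStandard f then c n l m ⟨f, h⟩ else 0

/-- The diagonal coefficient: `1 / r` with `r = res(b) - res(a)` if `a`, `b` lie in the same tableau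
of `f`, and `0` otherwise. -/
def coef (a b : Fin n) (f : Cell l m ≃ Fin n) : ℝ :=
  if (f.symm a).comp = (f.symm b).comp then
    (((f.symm b).res - (f.symm a).res : ℤ) : ℝ)⁻¹
  else 0

/-- The action of the adjacent transposition `s = (a, b)`, `b = a + 1`, in Young's orthogonal form:
`s c_T = d c_T + √(1 - d²) c_{sT}`, where `d = 1 / r` if `a`, `b` are in the same tableau of `T` and
`d = 0` otherwise.  So `s c_T = c_{sT}` if `a`, `b` are in different tableaux, `s c_T = c_T` (resp.
`-c_T`) if they are in the same row (resp. column) of one tableau, where `r = 1` (resp. `-1`), and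
the matrix of `s` on `c_T, c_{sT}` is `[[1/r, √(1-1/r²)], [√(1-1/r²), -1/r]]` in the other cases. -/
def adjOp (n : ℕ) (l m : YoungDiagram) (a b : Fin n) : Module.End ℂ (S n l m) :=
  (c n l m).constr ℂ fun T =>
    ((coef a b T.filling : ℝ) : ℂ) • c n l m T +
      ((√(1 - coef a b T.filling ^ 2) : ℝ) : ℂ) • cFill (T.filling.trans (swap a b))

/-- The character of `{±1}^n` on `c_f`: `t_i` acts by `-1` exactly if `i` is in the second
tableau. -/
def weightChar (x : Fin n → ℤˣ) (f : Cell l m ≃ Fin n) : ℂ :=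
  ∏ i, if (f.symm i).comp then (((x i : ℤˣ) : ℤ) : ℂ) else 1

/-- The action of `{±1}^n` on `S^{(l,m)}`. -/
def signOp (n : ℕ) (l m : YoungDiagram) (x : Fin n → ℤˣ) : Module.End ℂ (S n l m) :=
  (c n l m).constr ℂ fun T => weightChar x T.filling • c n l m T

/-! ### These operators define a representation of the group -/

section Perm

variable {M : Type*} [Monoid M]

theorem swap_braid {α : Type*} [DecidableEq α] {a b d : α} (hab : a ≠ b) (had : a ≠ d)
    (hbd : b ≠ d) : swap a b * swap b d * swap a b = swap b d * swap a b * swap b d := by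
  have h := swap_mul_swap_mul_swap hbd.symm had.symm
  rw [swap_comm b a, swap_comm d b] at h
  rw [h, swap_mul_swap_mul_swap hab had, swap_comm]

theorem swap_commute {α : Type*} [DecidableEq α] {a b c d : α} (hac : a ≠ c) (had : a ≠ d)
    (hbc : b ≠ c) (hbd : b ≠ d) : swap a b * swap c d = swap c d * swap a b := by
  refine (Perm.Disjoint.commute ?_)
  intro x
  by_cases hx : x = c ∨ x = d
  · left
    rcases hx with rfl | rfl
    · exact swap_apply_of_ne_of_ne hac.symm hbc.symm
    · exact swap_apply_of_ne_of_ne had.symm hbd.symm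
  · right
    push Not at hx
    exact swap_apply_of_ne_of_ne hx.1 hx.2

theorem adj_induction {p : Perm (Fin n) → Prop} (h1 : p 1)
    (hs : ∀ (τ : Perm (Fin n)) (a b : Fin n), a.val + 1 = b.val → p τ → p (τ * swap a b))
    (τ : Perm (Fin n)) : p τ := by
  cases n with
  | zero => rw [Subsingleton.elim τ 1]; exact h1
  | succ n =>
    have hτ : τ ∈ Submonoid.closure (Set.range fun i : Fin n => swap i.castSucc i.succ) := by
      rw [Perm.mclosure_swap_castSucc_succ]; trivial
    induction hτ using Submonoid.closure_induction_right with
    | one => exact h1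
    | mul_right x _ y hy ih =>
      obtain ⟨i, rfl⟩ := hy
      exact hs x _ _ (by simp) ih

theorem meas_lt (σ : Perm (Fin n)) (a b : Fin n) (hab : a.val + 1 = b.val) (h : σ b < σ a) :
    ∑ k : Fin n, (n - k.val) * ((σ * swap a b) k).val < ∑ k : Fin n, (n - k.val) * (σ k).val := by
  have hne : a ≠ b := by rintro rfl; omega
  have key : ∀ τ : Perm (Fin n), ∑ k : Fin n, (n - k.val) * (τ k).val =
      (n - a.val) * (τ a).val + ((n - b.val) * (τ b).val +
        ∑ k ∈ (Finset.univ.erase a).erase b, (n - k.val) * (τ k).val) := by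
    intro τ
    rw [← Finset.add_sum_erase _ _ (Finset.mem_univ a),
      ← Finset.add_sum_erase _ _ (Finset.mem_erase.2 ⟨hne.symm, Finset.mem_univ b⟩)]
  rw [key, key σ]
  have h3 : ∑ k ∈ (Finset.univ.erase a).erase b, (n - k.val) * ((σ * swap a b) k).val =
      ∑ k ∈ (Finset.univ.erase a).erase b, (n - k.val) * (σ k).val := by
    refine Finset.sum_congr rfl fun k hk => ?_
    simp only [Finset.mem_erase] at hk
    rw [Perm.mul_apply, swap_apply_of_ne_of_ne hk.2.1 hk.1]
  rw [h3]
  simp only [Perm.mul_apply, swap_apply_left, swap_apply_right]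
  obtain ⟨k, hk⟩ : ∃ k, n - a.val = k + 1 := ⟨n - a.val - 1, by omega⟩
  have hk' : n - b.val = k := by omega
  rw [hk, hk']
  have : (σ b).val < (σ a).val := h
  nlinarith

open Classical in
def permAux (A : Fin n → Fin n → M) (σ : Perm (Fin n)) : M :=
  if h : ∃ p : Fin n × Fin n, p.1.val + 1 = p.2.val ∧ σ p.2 < σ p.1 then
    permAux A (σ * swap h.choose.1 h.choose.2) * A h.choose.1 h.choose.2
  else 1
termination_by ∑ k : Fin n, (n - k.val) * (σ k).val
decreasing_by exact meas_lt σ _ _ h.choose_spec.1 h.choose_spec.2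

/-- Operators that satisfy the braid relations of type A and square to `1` extend to the symmetric
group. -/
theorem existsUnique_permHom (A : Fin n → Fin n → M)
    (hsq : ∀ a b : Fin n, a.val + 1 = b.val → A a b * A a b = 1)
    (hbr : ∀ a b c : Fin n, a.val + 1 = b.val → b.val + 1 = c.val →
      A a b * A b c * A a b = A b c * A a b * A b c)
    (hcomm : ∀ a b c d : Fin n, a.val + 1 = b.val → c.val + 1 = d.val → b < c →
      A a b * A c d = A c d * A a b) :
    ∃! P : Perm (Fin n) →* M, ∀ a b : Fin n, a.val + 1 = b.val → P (swap a b) = A a b := by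
  have desc : ∀ (N : ℕ) (σ : Perm (Fin n)), ∑ k : Fin n, (n - k.val) * (σ k).val < N →
      ∀ a b : Fin n, a.val + 1 = b.val → σ b < σ a →
        permAux A σ = permAux A (σ * swap a b) * A a b := by
    intro N
    induction N with
    | zero => intro σ h; omega
    | succ N ih =>
      intro σ hN a b hab h
      have hex : ∃ p : Fin n × Fin n, p.1.val + 1 = p.2.val ∧ σ p.2 < σ p.1 := ⟨(a, b), hab, h⟩
      have main : ∀ a b c d : Fin n, a.val + 1 = b.val → σ b < σ a → c.val + 1 = d.val →
          σ d < σ c → a < c →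
          permAux A (σ * swap c d) * A c d = permAux A (σ * swap a b) * A a b := by
        clear hex h hab a b
        intro a b c d hab h hcd h' hac
        have m1 := meas_lt σ a b hab h
        have m2 := meas_lt σ c d hcd h'
        have hne1 : a ≠ b := by rintro rfl; omega
        have hne2 : c ≠ d := by rintro rfl; omega
        rcases eq_or_ne b c with rfl | hbc
        · -- adjacent
          have had : a ≠ d := by rintro rfl; omega
          have sd : swap a b d = d := swap_apply_of_ne_of_ne had.symm hne2.symm
          have sa : swap b d a = a := swap_apply_of_ne_of_ne hne1 had
          have e1 := ih (σ * swap a b) (by omega) b d hcd (by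
            simp only [Perm.mul_apply, sd, swap_apply_right]; exact h'.trans h)
          have e2 := ih (σ * swap b d) (by omega) a b hab (by
            simp only [Perm.mul_apply, sa, swap_apply_left]; exact h'.trans h)
          have m3 := meas_lt (σ * swap a b) b d hcd (by
            simp only [Perm.mul_apply, sd, swap_apply_right]; exact h'.trans h)
          have m4 := meas_lt (σ * swap b d) a b hab (by
            simp only [Perm.mul_apply, sa, swap_apply_left]; exact h'.trans h)
          have e3 := ih (σ * swap a b * swap b d) (by omega) a b hab (by
            simp only [Perm.mul_apply, swap_apply_left, sa, sd]; exact h')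
          have e4 := ih (σ * swap b d * swap a b) (by omega) b d hcd (by
            simp only [Perm.mul_apply, swap_apply_right, sa, sd]; exact h)
          have hs : σ * swap a b * swap b d * swap a b = σ * swap b d * swap a b * swap b d := by
            simp only [mul_assoc]
            rw [← mul_assoc (swap a b), swap_braid hne1 had hne2, mul_assoc]
          rw [e1, e2, e3, e4, hs]
          simp only [mul_assoc]
          rw [← mul_assoc (A b d) (A a b) (A b d), ← hbr a b d hab hcd]
          simp only [mul_assoc]
        · have hbc' : b < c := by
            rw [Fin.lt_def] at hac ⊢
            have : b.val ≠ c.val := fun h => hbc (Fin.ext h)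
            omega
          have hac' : a ≠ c := hac.ne
          have had : a ≠ d := by rintro rfl; rw [Fin.lt_def] at hac; omega
          have hbd : b ≠ d := by rintro rfl; rw [Fin.lt_def] at hbc'; omega
          have d1 : (σ * swap a b) d < (σ * swap a b) c := by
            simp only [Perm.mul_apply, swap_apply_of_ne_of_ne hac'.symm hbc.symm,
              swap_apply_of_ne_of_ne had.symm hbd.symm]
            exact h'
          have d2 : (σ * swap c d) b < (σ * swap c d) a := by
            simp only [Perm.mul_apply, swap_apply_of_ne_of_ne hac' had,
              swap_apply_of_ne_of_ne hbc hbd]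
            exact h
          have e1 := ih (σ * swap a b) (by omega) c d hcd d1
          have e2 := ih (σ * swap c d) (by omega) a b hab d2
          have hs : σ * swap a b * swap c d = σ * swap c d * swap a b := by
            rw [mul_assoc, swap_commute hac' had hbc hbd, mul_assoc]
          rw [e1, e2, hs, mul_assoc _ (A c d), mul_assoc _ (A a b), hcomm a b c d hab hcd hbc']
      rw [permAux, dif_pos hex]
      obtain ⟨h1, h2⟩ := hex.choose_spec
      rcases lt_trichotomy a hex.choose.1 with hlt | heq | hgt
      · exact main _ _ _ _ hab h h1 h2 hlt
      · have : hex.choose.2 = b := Fin.ext (by rw [← h1, ← heq, hab])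
        rw [this, ← heq]
      · exact (main _ _ _ _ h1 h2 hab h hgt).symm
  have step : ∀ (σ : Perm (Fin n)) (a b : Fin n), a.val + 1 = b.val →
      permAux A (σ * swap a b) = permAux A σ * A a b := by
    intro σ a b hab
    have hne : a ≠ b := by rintro rfl; omega
    rcases lt_or_gt_of_ne (fun h => hne (σ.injective h) : σ a ≠ σ b) with h | h
    · have := desc _ (σ * swap a b) (Nat.lt_succ_self _) a b hab (by
        simpa only [Perm.mul_apply, swap_apply_left, swap_apply_right] using h)
      rw [this, mul_assoc, swap_mul_self, mul_one]
    · rw [desc _ σ (Nat.lt_succ_self _) a b hab h, mul_assoc, hsq a b hab, mul_one]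
  have one : permAux A (1 : Perm (Fin n)) = 1 := by
    rw [permAux, dif_neg]
    rintro ⟨p, h1, h2⟩
    simp only [Perm.one_apply, Fin.lt_def] at h2
    omega
  have mul : ∀ τ σ : Perm (Fin n), permAux A (σ * τ) = permAux A σ * permAux A τ := by
    intro τ
    refine adj_induction (p := fun τ => ∀ σ : Perm (Fin n),
      permAux A (σ * τ) = permAux A σ * permAux A τ) ?_ ?_ τ
    · intro σ; rw [mul_one, one, mul_one]
    · intro τ a b hab ih σ
      rw [← mul_assoc, step _ a b hab, step _ a b hab, ih, mul_assoc]
  refine ⟨⟨⟨permAux A, one⟩, fun σ τ => mul τ σ⟩, fun a b hab => ?_, fun Q hQ => ?_⟩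
  · have := step 1 a b hab
    rwa [one, one_mul, one_mul] at this
  · ext τ
    refine adj_induction (p := fun τ => Q τ = permAux A τ) ?_ ?_ τ
    · rw [map_one, one]
    · intro τ a b hab ih
      rw [map_mul, ih, step _ a b hab, hQ a b hab]

end Perm

theorem coef_trans (a b u v : Fin n) (f : Cell l m ≃ Fin n) :
    coef u v (f.trans (swap a b)) = coef (swap a b u) (swap a b v) f := by
  simp [coef]

theorem coef_swap (a b : Fin n) (f : Cell l m ≃ Fin n) : coef b a f = - coef a b f := by
  unfold coef
  by_cases h : (f.symm a).comp = (f.symm b).comp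
  · rw [if_pos h, if_pos h.symm, ← inv_neg]
    push_cast
    congr 1
    ring
  · rw [if_neg h, if_neg (fun h' => h h'.symm), neg_zero]

theorem coef_sq_le (a b : Fin n) (f : Cell l m ≃ Fin n) : coef a b f ^ 2 ≤ 1 := by
  unfold coef
  split_ifs
  · generalize (f.symm b).res - (f.symm a).res = z
    rcases eq_or_ne z 0 with rfl | hz
    · simp
    · have h1 : (1 : ℝ) ≤ |(z : ℝ)| := by exact_mod_cast Int.one_le_abs hz
      rw [inv_pow, ← sq_abs]
      exact inv_le_one_of_one_le₀ (one_le_pow₀ h1)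
  · norm_num

/-- The off-diagonal coefficient. -/
def offCoef (a b : Fin n) (f : Cell l m ≃ Fin n) : ℝ := √(1 - coef a b f ^ 2)

theorem offCoef_sq (a b : Fin n) (f : Cell l m ≃ Fin n) :
    offCoef a b f * offCoef a b f = 1 - coef a b f ^ 2 :=
  Real.mul_self_sqrt (by linarith [coef_sq_le a b f])

theorem mem_cell {b : Bool} {r s r' s' : ℕ} (h : (r, s) ∈ (bif b then m else l))
    (hr : r' ≤ r) (hs : s' ≤ s) : (r', s') ∈ (bif b then m else l) :=
  YoungDiagram.up_left_mem _ hr hs h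

theorem IsStandard.mono {f : Cell l m ≃ Fin n} (hf : IsStandard f) {p q : Cell l m}
    (h : p.comp = q.comp) (hr : p.row ≤ q.row) (hc : p.col ≤ q.col) : f p ≤ f q := by
  obtain ⟨⟨b, r, s⟩, hp⟩ := p
  obtain ⟨⟨b', r', s'⟩, hq⟩ := q
  simp only [Cell.comp, Cell.row, Cell.col] at h hr hc
  subst h
  have hx : (r, s') ∈ (bif b then m else l) := mem_cell hq hr le_rfl
  have h1 : f ⟨(b, r, s), hp⟩ ≤ f ⟨(b, r, s'), hx⟩ := by
    rcases hc.eq_or_lt with rfl | hc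
    · exact le_rfl
    · exact (hf.1 ⟨(b, r, s), hp⟩ ⟨(b, r, s'), hx⟩ rfl rfl hc).le
  refine h1.trans ?_
  rcases hr.eq_or_lt with rfl | hr
  · exact le_rfl
  · exact (hf.2 ⟨(b, r, s'), hx⟩ ⟨(b, r', s'), hq⟩ rfl rfl hr).le

/-- Two entries of equal content in one tableau differ by at least `3`. -/
theorem IsStandard.three_le {f : Cell l m ≃ Fin n} (hf : IsStandard f) {p q : Cell l m}
    (h : p.comp = q.comp) (hres : p.res = q.res) (hlt : f p < f q) :
    (f p).val + 3 ≤ (f q).val := by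
  have hrow : p.row < q.row := by
    by_contra hcon
    have h1 : q.row ≤ p.row := not_lt.1 hcon
    have h2 : q.col ≤ p.col := by unfold Cell.res at hres; omega
    exact absurd (hf.mono h.symm h1 h2) (not_le.2 hlt)
  have hcol : p.col < q.col := by unfold Cell.res at hres; omega
  clear hres
  obtain ⟨⟨b, r, s⟩, hp⟩ := p
  obtain ⟨⟨b', r', s'⟩, hq⟩ := q
  simp only [Cell.comp, Cell.row, Cell.col] at h hrow hcol
  subst h
  have hx : (r, s + 1) ∈ (bif b then m else l) := mem_cell hq hrow.le hcol
  have hy : (r + 1, s) ∈ (bif b then m else l) := mem_cell hq hrow hcol.le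
  have a1 : f ⟨(b, r, s), hp⟩ < f ⟨(b, r, s + 1), hx⟩ := hf.1 _ _ rfl rfl (Nat.lt_succ_self s)
  have a2 : f ⟨(b, r, s), hp⟩ < f ⟨(b, r + 1, s), hy⟩ := hf.2 _ _ rfl rfl (Nat.lt_succ_self r)
  have hz : (r + 1, s + 1) ∈ (bif b then m else l) := mem_cell hq hrow hcol
  have a3 : f ⟨(b, r, s + 1), hx⟩ < f ⟨(b, r + 1, s + 1), hz⟩ :=
    hf.2 _ _ rfl rfl (Nat.lt_succ_self r)
  have a4 : f ⟨(b, r + 1, s), hy⟩ < f ⟨(b, r + 1, s + 1), hz⟩ :=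
    hf.1 _ _ rfl rfl (Nat.lt_succ_self s)
  have a5 : f ⟨(b, r + 1, s + 1), hz⟩ ≤ f ⟨(b, r', s'), hq⟩ := hf.mono rfl hrow hcol
  have a6 : f ⟨(b, r, s + 1), hx⟩ ≠ f ⟨(b, r + 1, s), hy⟩ := by
    intro he
    have := congrArg Subtype.val (f.injective he)
    simp at this
  rw [Fin.lt_def] at a1 a2 a3 a4
  rw [Fin.le_def] at a5
  have a7 := fun h => a6 (Fin.ext h)
  omega

theorem res_ne {f : Cell l m ≃ Fin n} (hf : IsStandard f) {a b : Fin n} (hab : a < b)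
    (hab' : b.val < a.val + 3) (h : (f.symm a).comp = (f.symm b).comp) :
    (f.symm b).res - (f.symm a).res ≠ 0 := by
  intro h0
  have := hf.three_le h (by omega) (by simpa using hab)
  simp only [apply_symm_apply] at this
  omega

/-- If `s = (a, b)`, `b = a + 1`, destroys standardness, then `a`, `b` are neighbours in a row or
column. -/
theorem coef_of_not_isStandard {f : Cell l m ≃ Fin n} (hf : IsStandard f) {a b : Fin n}
    (hab : a.val + 1 = b.val) (h : ¬ IsStandard (f.trans (swap a b))) : coef a b f ^ 2 = 1 := by
  have hval : ∀ p q : Cell l m, f p < f q → ¬ (f.trans (swap a b)) p < (f.trans (swap a b)) q →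
      f p = a ∧ f q = b := by
    intro p q h1 h2
    simp only [trans_apply] at h2
    rw [Fin.lt_def] at h1 h2
    by_cases hpa : f p = a
    · by_cases hqb : f q = b
      · exact ⟨hpa, hqb⟩
      · have hqa : f q ≠ a := by rintro h; rw [h, hpa] at h1; omega
        rw [hpa, swap_apply_left, swap_apply_of_ne_of_ne hqa hqb] at h2
        rw [hpa] at h1
        have : (f q).val ≠ b.val := fun h => hqb (Fin.ext h)
        omega
    · by_cases hpb : f p = b
      · have hqa : f q ≠ a := by rintro h; rw [h, hpb] at h1; omega
        have hqb : f q ≠ b := by rintro h; rw [h, hpb] at h1; omega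
        rw [hpb, swap_apply_right, swap_apply_of_ne_of_ne hqa hqb] at h2
        rw [hpb] at h1
        omega
      · rw [swap_apply_of_ne_of_ne hpa hpb] at h2
        by_cases hqa : f q = a
        · rw [hqa, swap_apply_left] at h2
          rw [hqa] at h1
          omega
        · by_cases hqb : f q = b
          · rw [hqb, swap_apply_right] at h2
            rw [hqb] at h1
            have : (f p).val ≠ a.val := fun h => hpa (Fin.ext h)
            omega
          · rw [swap_apply_of_ne_of_ne hqa hqb] at h2
            omega
  have fin : ∀ p q : Cell l m, f p = a → f q = b → p.comp = q.comp →
      (q.res - p.res = 1 ∨ q.res - p.res = -1) → coef a b f ^ 2 = 1 := by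
    intro p q hp hq hc hr
    unfold coef
    rw [← hp, ← hq, symm_apply_apply, symm_apply_apply, if_pos hc]
    rcases hr with hr | hr <;> rw [hr] <;> norm_num
  unfold IsStandard at h
  rw [not_and_or] at h
  push Not at h
  rcases h with ⟨p, q, hc, hr, hl, hn⟩ | ⟨p, q, hc, hr, hl, hn⟩
  · obtain ⟨hp, hq⟩ := hval p q (hf.1 p q hc hr hl) (not_lt.2 hn)
    refine fin p q hp hq hc (Or.inl ?_)
    suffices hs : q.col = p.col + 1 by unfold Cell.res; omega
    by_contra hne
    obtain ⟨⟨c, r, s⟩, hpm⟩ := p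
    obtain ⟨⟨c', r', s'⟩, hqm⟩ := q
    simp only [Cell.comp, Cell.row, Cell.col] at hc hr hl hne
    subst hc hr
    have hx : (r, s + 1) ∈ (bif c then m else l) := mem_cell hqm le_rfl hl
    have h1 := hf.1 ⟨(c, r, s), hpm⟩ ⟨(c, r, s + 1), hx⟩ rfl rfl (Nat.lt_succ_self s)
    have h2 := hf.1 ⟨(c, r, s + 1), hx⟩ ⟨(c, r, s'), hqm⟩ rfl rfl
      (by simp only [Cell.col]; omega)
    rw [hp, Fin.lt_def] at h1
    rw [hq, Fin.lt_def] at h2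
    omega
  · obtain ⟨hp, hq⟩ := hval p q (hf.2 p q hc hr hl) (not_lt.2 hn)
    refine fin p q hp hq hc (Or.inr ?_)
    suffices hs : q.row = p.row + 1 by unfold Cell.res; omega
    by_contra hne
    obtain ⟨⟨c, r, s⟩, hpm⟩ := p
    obtain ⟨⟨c', r', s'⟩, hqm⟩ := q
    simp only [Cell.comp, Cell.row, Cell.col] at hc hr hl hne
    subst hc hr
    have hx : (r + 1, s) ∈ (bif c then m else l) := mem_cell hqm hl le_rfl
    have h1 := hf.2 ⟨(c, r, s), hpm⟩ ⟨(c, r + 1, s), hx⟩ rfl rfl (Nat.lt_succ_self r)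
    have h2 := hf.2 ⟨(c, r + 1, s), hx⟩ ⟨(c, r', s), hqm⟩ rfl rfl
      (by simp only [Cell.row]; omega)
    rw [hp, Fin.lt_def] at h1
    rw [hq, Fin.lt_def] at h2
    omega

theorem isStandard_or {f : Cell l m ≃ Fin n} (hf : IsStandard f) {a b : Fin n}
    (hab : a.val + 1 = b.val) : IsStandard (f.trans (swap a b)) ∨ offCoef a b f = 0 := by
  by_cases h : IsStandard (f.trans (swap a b))
  · exact Or.inl h
  · right
    rw [offCoef, coef_of_not_isStandard hf hab h, sub_self, Real.sqrt_zero]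

theorem adjOp_cFill {f : Cell l m ≃ Fin n} (hf : IsStandard f) (a b : Fin n) :
    adjOp n l m a b (cFill f) = ((coef a b f : ℝ) : ℂ) • cFill f +
      ((offCoef a b f : ℝ) : ℂ) • cFill (f.trans (swap a b)) := by
  have : cFill f = c n l m ⟨f, hf⟩ := dif_pos hf
  rw [this, adjOp, Module.Basis.constr_basis]
  rfl

theorem smul_adjOp_cFill {f : Cell l m ≃ Fin n} {k : ℝ} (hf : IsStandard f ∨ k = 0)
    (a b : Fin n) :
    (k : ℂ) • adjOp n l m a b (cFill f) = (k : ℂ) • (((coef a b f : ℝ) : ℂ) • cFill f +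
      ((offCoef a b f : ℝ) : ℂ) • cFill (f.trans (swap a b))) := by
  rcases hf with hf | rfl
  · rw [adjOp_cFill hf]
  · simp

theorem signOp_cFill (x : Fin n → ℤˣ) (f : Cell l m ≃ Fin n) :
    signOp n l m x (cFill f) = weightChar x f • cFill f := by
  unfold cFill
  split_ifs with h
  · rw [signOp, Module.Basis.constr_basis]
  · simp

theorem end_ext {A B : Module.End ℂ (S n l m)}
    (h : ∀ f : Cell l m ≃ Fin n, IsStandard f → A (cFill f) = B (cFill f)) : A = B := by
  refine (c n l m).ext fun T => ?_
  have : cFill T.filling = c n l m T := dif_pos T.standard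
  rw [← this]
  exact h T.filling T.standard

theorem adjOp_sq (a b : Fin n) (hab : a.val + 1 = b.val) :
    adjOp n l m a b * adjOp n l m a b = 1 := by
  refine end_ext fun f hf => ?_
  rw [Module.End.mul_apply, adjOp_cFill hf, map_add, map_smul, map_smul, adjOp_cFill hf,
    smul_adjOp_cFill (isStandard_or hf hab)]
  have h0 : coef a b (f.trans (swap a b)) = - coef a b f := by
    rw [coef_trans, swap_apply_left, swap_apply_right, coef_swap]
  have h0' : offCoef a b (f.trans (swap a b)) = offCoef a b f := by
    rw [offCoef, h0, neg_sq, offCoef]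
  have h1 : (f.trans (swap a b)).trans (swap a b) = f := by
    ext x; simp
  have h2 : ((offCoef a b f : ℝ) : ℂ) * ((offCoef a b f : ℝ) : ℂ) =
      1 - ((coef a b f : ℝ) : ℂ) ^ 2 := by
    exact_mod_cast offCoef_sq a b f
  rw [h0, h0', h1]
  rw [Module.End.one_apply]
  push_cast
  match_scalars
  · linear_combination h2
  · ring

theorem braid_aux {V : Type*} [AddCommGroup V] [Module ℂ V] (P Q : Module.End ℂ V)
    (e e1 e2 e12 e21 e121 : V) (x y z ox oy oz : ℂ)
    (L1 : P e = x • e + ox • e1) (L2 : Q e = y • e + oy • e2)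
    (L3 : ox • P e1 = ox • (-x • e1 + ox • e)) (L4 : ox • Q e1 = ox • (z • e1 + oz • e12))
    (L5 : oy • Q e2 = oy • (-y • e2 + oy • e)) (L6 : oy • P e2 = oy • (z • e2 + oz • e21))
    (L7 : (ox * oz) • P e12 = (ox * oz) • (y • e12 + oy • e121))
    (L8 : (oy * oz) • Q e21 = (oy * oz) • (x • e21 + ox • e121))
    (q1 : ox * ox = 1 - x ^ 2) (q2 : oy * oy = 1 - y ^ 2) (rel : x * y = z * (x + y)) :
    P (Q (P e)) = Q (P (Q e)) := by
  have h1 : Q (P e) = x • (y • e + oy • e2) + ox • (z • e1 + oz • e12) := by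
    rw [L1, map_add, map_smul, map_smul, L2, L4]
  have h2 : P (Q (P e)) =
      (x * y) • P e + x • (oy • P e2) + z • (ox • P e1) + (ox * oz) • P e12 := by
    rw [h1]; simp only [map_add, map_smul]; module
  have h3 : P (Q e) = y • (x • e + ox • e1) + oy • (z • e2 + oz • e21) := by
    rw [L2, map_add, map_smul, map_smul, L1, L6]
  have h4 : Q (P (Q e)) =
      (x * y) • Q e + y • (ox • Q e1) + z • (oy • Q e2) + (oy * oz) • Q e21 := by
    rw [h3]; simp only [map_add, map_smul]; module
  rw [h2, h4, L1, L2, L3, L4, L5, L6, L7, L8]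
  match_scalars
  · linear_combination z * q1 - z * q2 + (x - y) * rel
  · linear_combination ox * rel
  · linear_combination (-oy) * rel
  · ring
  · ring
  · ring

theorem adjOp_braid (a b d : Fin n) (hab : a.val + 1 = b.val) (hbd : b.val + 1 = d.val) :
    adjOp n l m a b * adjOp n l m b d * adjOp n l m a b =
      adjOp n l m b d * adjOp n l m a b * adjOp n l m b d := by
  have n1 : a ≠ b := by rintro rfl; omega
  have n2 : b ≠ d := by rintro rfl; omega
  have n3 : a ≠ d := by rintro rfl; omega
  have s1 : swap a b d = d := swap_apply_of_ne_of_ne n3.symm n2.symm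
  have s2 : swap b d a = a := swap_apply_of_ne_of_ne n1 n3
  refine end_ext fun f hf => ?_
  set x := coef a b f with hx
  set y := coef b d f with hy
  set z := coef a d f with hz
  have rel : x * y = z * (x + y) := by
    have r1 := res_ne hf (a := a) (b := b) (by rw [Fin.lt_def]; omega) (by omega)
    have r2 := res_ne hf (a := b) (b := d) (by rw [Fin.lt_def]; omega) (by omega)
    have r3 := res_ne hf (a := a) (b := d) (by rw [Fin.lt_def]; omega) (by omega)
    rw [hx, hy, hz]
    unfold coef
    by_cases h1 : (f.symm a).comp = (f.symm b).comp
    · by_cases h2 : (f.symm b).comp = (f.symm d).comp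
      · have h3 := h1.trans h2
        rw [if_pos h1, if_pos h2, if_pos h3]
        have r1' : (((f.symm b).res - (f.symm a).res : ℤ) : ℝ) ≠ 0 := by exact_mod_cast r1 h1
        have r2' : (((f.symm d).res - (f.symm b).res : ℤ) : ℝ) ≠ 0 := by exact_mod_cast r2 h2
        have r3' : (((f.symm d).res - (f.symm a).res : ℤ) : ℝ) ≠ 0 := by exact_mod_cast r3 h3
        field_simp
        push_cast
        ring
      · have h3 : (f.symm a).comp ≠ (f.symm d).comp := fun h => h2 (h1.symm.trans h)
        rw [if_neg h2, if_neg h3]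
        ring
    · rw [if_neg h1]
      by_cases h2 : (f.symm b).comp = (f.symm d).comp
      · have h3 : (f.symm a).comp ≠ (f.symm d).comp := fun h => h1 (h.trans h2.symm)
        rw [if_neg h3]
        ring
      · rw [if_neg h2]
        ring
  set f1 := f.trans (swap a b) with hf1
  set f2 := f.trans (swap b d) with hf2
  set f12 := f1.trans (swap b d) with hf12
  set f21 := f2.trans (swap a b) with hf21
  have hlast : f12.trans (swap a b) = f21.trans (swap b d) := by
    have := swap_braid n1 n3 n2
    apply Equiv.ext
    intro p
    exact congrArg (fun σ : Perm (Fin n) => σ (f p)) this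
  have i1 : f1.trans (swap a b) = f := by ext p; simp [hf1]
  have i2 : f2.trans (swap b d) = f := by ext p; simp [hf2]
  have c1 : coef a b f1 = -x := by rw [hf1, coef_trans, swap_apply_left, swap_apply_right, coef_swap]
  have c2 : coef b d f1 = z := by rw [hf1, coef_trans, swap_apply_right, s1]
  have c3 : coef b d f2 = -y := by rw [hf2, coef_trans, swap_apply_left, swap_apply_right, coef_swap]
  have c4 : coef a b f2 = z := by rw [hf2, coef_trans, swap_apply_left, s2]
  have c5 : coef a b f12 = y := by
    rw [hf12, coef_trans, s2, swap_apply_left, hf1, coef_trans, swap_apply_left, s1]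
  have c6 : coef b d f21 = x := by
    rw [hf21, coef_trans, s1, swap_apply_right, hf2, coef_trans, swap_apply_right, s2]
  have o1 := isStandard_or hf hab
  have o2 := isStandard_or hf hbd
  have o12 : IsStandard f12 ∨ offCoef a b f * offCoef b d f1 = 0 := by
    rcases o1 with h | h
    · rcases isStandard_or h hbd with h' | h'
      · exact Or.inl h'
      · right; rw [h', mul_zero]
    · right; rw [h, zero_mul]
  have o21 : IsStandard f21 ∨ offCoef b d f * offCoef a b f2 = 0 := by
    rcases o2 with h | h
    · rcases isStandard_or h hab with h' | h'
      · exact Or.inl h'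
      · right; rw [h', mul_zero]
    · right; rw [h, zero_mul]
  have L1 := adjOp_cFill hf a b
  have L2 := adjOp_cFill hf b d
  have L3 := smul_adjOp_cFill o1 a b
  have L4 := smul_adjOp_cFill o1 b d
  have L5 := smul_adjOp_cFill o2 b d
  have L6 := smul_adjOp_cFill o2 a b
  have L7 := smul_adjOp_cFill o12 a b
  have L8 := smul_adjOp_cFill o21 b d
  have q1 : ((offCoef a b f : ℝ) : ℂ) * ((offCoef a b f : ℝ) : ℂ) = 1 - (x : ℂ) ^ 2 := by
    exact_mod_cast offCoef_sq a b f
  have q2 : ((offCoef b d f : ℝ) : ℂ) * ((offCoef b d f : ℝ) : ℂ) = 1 - (y : ℂ) ^ 2 := by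
    exact_mod_cast offCoef_sq b d f
  have w1 : offCoef a b f1 = offCoef a b f := by rw [offCoef, c1, neg_sq]; rfl
  have w2 : offCoef b d f2 = offCoef b d f := by rw [offCoef, c3, neg_sq]; rfl
  have w3 : offCoef a b f2 = offCoef b d f1 := by rw [offCoef, c4, offCoef, c2]
  have w4 : offCoef a b f12 = offCoef b d f := by rw [offCoef, c5]; rfl
  have w5 : offCoef b d f21 = offCoef a b f := by rw [offCoef, c6]; rfl
  rw [i1] at L3
  rw [i2] at L5
  rw [c1, w1] at L3
  rw [c3, w2] at L5
  rw [c2] at L4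
  rw [c4, w3] at L6
  rw [c5, w4] at L7
  rw [w3, c6, w5, ← hlast] at L8
  push_cast at L3 L5 L7 L8
  simp only [Module.End.mul_apply]
  exact braid_aux _ _ _ _ _ _ _ _ _ _ _ _ _ _ L1 L2 L3 L4 L5 L6 L7 L8 q1 q2
    (by exact_mod_cast rel)

theorem adjOp_comm (a b d e : Fin n) (hab : a.val + 1 = b.val) (hde : d.val + 1 = e.val)
    (hbd : b < d) : adjOp n l m a b * adjOp n l m d e = adjOp n l m d e * adjOp n l m a b := by
  have hbd' := Fin.lt_def.1 hbd
  have n1 : a ≠ d := by rintro rfl; omega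
  have n2 : a ≠ e := by rintro rfl; omega
  have n3 : b ≠ d := by rintro rfl; omega
  have n4 : b ≠ e := by rintro rfl; omega
  refine end_ext fun f hf => ?_
  rw [Module.End.mul_apply, Module.End.mul_apply, adjOp_cFill hf, adjOp_cFill hf]
  simp only [map_add, map_smul]
  rw [adjOp_cFill hf, adjOp_cFill hf, smul_adjOp_cFill (isStandard_or hf hab),
    smul_adjOp_cFill (isStandard_or hf hde)]
  simp only [offCoef, coef_trans, swap_apply_of_ne_of_ne n1 n2, swap_apply_of_ne_of_ne n3 n4,
    swap_apply_of_ne_of_ne n1.symm n3.symm, swap_apply_of_ne_of_ne n2.symm n4.symm,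
    Equiv.trans_assoc]
  have h : (swap a b).trans (swap d e) = (swap d e).trans (swap a b) :=
    (swap_commute n1 n2 n3 n4).symm
  rw [h]
  module

/-- The permutations act on `S^{(l,m)}` through Young's orthogonal form. -/
theorem existsUnique_permRep (n : ℕ) (l m : YoungDiagram) :
    ∃! P : Perm (Fin n) →* Module.End ℂ (S n l m),
      ∀ a b : Fin n, a.val + 1 = b.val → P (swap a b) = adjOp n l m a b :=
  existsUnique_permHom _ adjOp_sq adjOp_braid adjOp_comm

/-- The representation of `𝔖_n` on `S^{(l,m)}`: the unique one in which the adjacent transpositions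
act by Young's orthogonal form. -/
def permRep (n : ℕ) (l m : YoungDiagram) : Perm (Fin n) →* Module.End ℂ (S n l m) :=
  (existsUnique_permRep n l m).choose

theorem permRep_swap (a b : Fin n) (hab : a.val + 1 = b.val) :
    permRep n l m (swap a b) = adjOp n l m a b :=
  (existsUnique_permRep n l m).choose_spec.1 a b hab

theorem weightChar_mul (x y : Fin n → ℤˣ) (f : Cell l m ≃ Fin n) :
    weightChar (x * y) f = weightChar x f * weightChar y f := by
  unfold weightChar
  rw [← Finset.prod_mul_distrib]
  refine Finset.prod_congr rfl fun i _ => ?_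
  split_ifs <;> simp

theorem weightChar_trans (x : Fin n → ℤˣ) (f : Cell l m ≃ Fin n) (σ : Perm (Fin n)) :
    weightChar x (f.trans σ) = weightChar (fun i => x (σ i)) f := by
  unfold weightChar
  rw [← Equiv.prod_comp σ]
  simp

theorem signOp_one : signOp n l m 1 = 1 := by
  refine end_ext fun f _ => ?_
  rw [signOp_cFill]
  simp [weightChar]

theorem signOp_mul (x y : Fin n → ℤˣ) :
    signOp n l m (x * y) = signOp n l m x * signOp n l m y := by
  refine end_ext fun f _ => ?_
  rw [Module.End.mul_apply, signOp_cFill, signOp_cFill, map_smul, signOp_cFill, weightChar_mul,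
    smul_smul, mul_comm]

theorem adjOp_signOp (a b : Fin n) (x : Fin n → ℤˣ) :
    adjOp n l m a b * signOp n l m x =
      signOp n l m (fun i => x (swap a b i)) * adjOp n l m a b := by
  refine end_ext fun f hf => ?_
  rw [Module.End.mul_apply, Module.End.mul_apply, signOp_cFill, map_smul, adjOp_cFill hf,
    map_add, map_smul, map_smul, signOp_cFill, signOp_cFill, weightChar_trans]
  have h2 : (fun i => (fun i => x (swap a b i)) (swap a b i)) = x := by
    funext i; simp
  rw [h2]
  by_cases h : (f.symm a).comp = (f.symm b).comp
  · have h1 : weightChar (fun i => x (swap a b i)) f = weightChar x f := by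
      rw [← weightChar_trans]
      unfold weightChar
      refine Finset.prod_congr rfl fun i _ => ?_
      have : (((f.trans (swap a b)).symm) i).comp = (f.symm i).comp := by
        change (f.symm ((swap a b).symm i)).comp = _
        rw [symm_swap]
        by_cases hia : i = a
        · rw [hia, swap_apply_left, h]
        · by_cases hib : i = b
          · rw [hib, swap_apply_right, h]
          · rw [swap_apply_of_ne_of_ne hia hib]
      rw [this]
    rw [h1]
    module
  · have : coef a b f = 0 := if_neg h
    rw [this]
    simp only [Complex.ofReal_zero, zero_smul, zero_add]
    module

theorem permRep_signOp (σ : Perm (Fin n)) (x : Fin n → ℤˣ) :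
    permRep n l m σ * signOp n l m x = signOp n l m (permAct n σ x) * permRep n l m σ := by
  revert x
  refine adj_induction (p := fun σ => ∀ x : Fin n → ℤˣ, permRep n l m σ * signOp n l m x =
    signOp n l m (permAct n σ x) * permRep n l m σ) ?_ ?_ σ
  · intro x
    simp
  · intro τ a b hab ih x
    rw [map_mul, permRep_swap a b hab, mul_assoc, adjOp_signOp, ← mul_assoc, ih, mul_assoc,
      map_mul, MulAut.mul_apply]
    congr 3

/-- The representation of `𝓑_n = {±1}^n ⋊ 𝔖_n` on `S^{(l,m)}`. -/
def rhoB (n : ℕ) (l m : YoungDiagram) : Representation ℂ (BGroup n) (S n l m) where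
  toFun g := signOp n l m g.left * permRep n l m g.right
  map_one' := by rw [SemidirectProduct.one_left, SemidirectProduct.one_right, signOp_one, map_one,
    one_mul]
  map_mul' g h := by
    rw [SemidirectProduct.mul_left, SemidirectProduct.mul_right, signOp_mul, map_mul]
    simp only [mul_assoc]
    rw [← mul_assoc (permRep n l m g.right), permRep_signOp, mul_assoc]

theorem rhoB_ofPerm (σ : Perm (Fin n)) : rhoB n l m (BGroup.ofPerm σ) = permRep n l m σ := by
  change signOp n l m 1 * permRep n l m σ = _
  rw [signOp_one, one_mul]

theorem rhoB_inl (x : Fin n → ℤˣ) :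
    rhoB n l m (SemidirectProduct.inl x) = signOp n l m x := by
  change signOp n l m x * permRep n l m 1 = _
  rw [map_one, mul_one]

/-- `t_i` acts on `c_T` by `-1` if `i` is in the second tableau, and by `1` otherwise. -/
theorem rhoB_t_cFill (i : Fin n) (f : Cell l m ≃ Fin n) :
    rhoB n l m (BGroup.t i) (cFill f) = (if (f.symm i).comp then (-1 : ℂ) else 1) • cFill f := by
  rw [BGroup.t, rhoB_inl, signOp_cFill]
  congr 1
  unfold weightChar
  rw [Finset.prod_eq_single i]
  · simp
  · intro j _ hj
    simp [Pi.mulSingle_eq_of_ne hj]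
  · simp

/-- The Young-Jucys-Murphy element `X_i = ∑_{k < i} ((k,i) + t_k t_i (k,i))`. -/
def yjm (i : Fin n) : MonoidAlgebra ℂ (BGroup n) :=
  ∑ k ∈ Finset.univ.filter (· < i), (MonoidAlgebra.of ℂ _ (BGroup.ofPerm (swap k i)) +
    MonoidAlgebra.of ℂ _ (BGroup.t k * BGroup.t i * BGroup.ofPerm (swap k i)))

theorem ofPerm_conj_t (σ : Perm (Fin n)) (i : Fin n) :
    BGroup.ofPerm σ * BGroup.t i = BGroup.t (σ i) * BGroup.ofPerm σ := by
  have h : permAct n σ (Pi.mulSingle i (-1)) = Pi.mulSingle (σ i) (-1 : ℤˣ) := by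
    funext j
    change (Pi.mulSingle i (-1 : ℤˣ) : Fin n → ℤˣ) (σ⁻¹ j) = _
    by_cases h : j = σ i
    · subst h
      simp
    · have h' : σ⁻¹ j ≠ i := by rintro rfl; simp at h
      rw [Pi.mulSingle_eq_of_ne h, Pi.mulSingle_eq_of_ne h']
  have h2 := SemidirectProduct.inl_aut (φ := permAct n) σ (Pi.mulSingle i (-1 : ℤˣ))
  rw [h] at h2
  rw [BGroup.t, BGroup.t, BGroup.ofPerm, h2, map_inv, inv_mul_cancel_right]

theorem ofPerm_mul (σ τ : Perm (Fin n)) :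
    BGroup.ofPerm (σ * τ) = BGroup.ofPerm σ * BGroup.ofPerm τ :=
  map_mul SemidirectProduct.inr σ τ

theorem yjm_succ (a b : Fin n) (hab : a.val + 1 = b.val) :
    yjm b = MonoidAlgebra.of ℂ _ (BGroup.ofPerm (swap a b)) * yjm a *
        MonoidAlgebra.of ℂ _ (BGroup.ofPerm (swap a b)) +
      (MonoidAlgebra.of ℂ _ (BGroup.ofPerm (swap a b)) +
        MonoidAlgebra.of ℂ _ (BGroup.t a * BGroup.t b * BGroup.ofPerm (swap a b))) := by
  have hset : Finset.univ.filter (· < b) = insert a (Finset.univ.filter (· < a)) := by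
    ext k
    simp only [Finset.mem_filter, Finset.mem_univ, true_and, Finset.mem_insert, Fin.lt_def,
      Fin.ext_iff]
    omega
  rw [yjm, hset, Finset.sum_insert (by
    rw [Finset.mem_filter]; exact fun h => lt_irrefl _ h.2), add_comm, yjm, Finset.mul_sum, Finset.sum_mul]
  congr 1
  refine Finset.sum_congr rfl fun k hk => ?_
  have hka : k.val < a.val := (Finset.mem_filter.mp hk).2
  have n1 : k ≠ a := by rintro rfl; omega
  have n2 : k ≠ b := by rintro rfl; omega
  have n3 : a ≠ b := by rintro rfl; omega
  have h1 : swap k b = swap a b * swap k a * swap a b := by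
    have := swap_mul_swap_mul_swap (x := k) (y := a) (z := b) n1 n2
    rw [this, swap_comm]
  have sk : swap a b k = k := swap_apply_of_ne_of_ne n1 n2
  rw [mul_add, add_mul]
  simp only [← map_mul]
  congr 2
  · rw [h1, ofPerm_mul, ofPerm_mul]
  · rw [h1, ofPerm_mul, ofPerm_mul]
    simp only [← mul_assoc]
    rw [ofPerm_conj_t, sk, mul_assoc (BGroup.t k) (BGroup.ofPerm _) (BGroup.t a), ofPerm_conj_t,
      swap_apply_left]
    simp only [← mul_assoc]

/-- `X_i` acts on `c_T` by twice the residue of the box of `T` that contains `i`.  Together with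
`rhoB_t_cFill` this says that `c_T` spans the weight space of the weight attached to `T`, so that
`S^{(l,m)}` is the simple module whose weights are those of the standard bitableaux of shape
`(l, m)`. -/
theorem rhoB_yjm_cFill (i : Fin n) (f : Cell l m ≃ Fin n) (hf : IsStandard f) :
    (rhoB n l m).asAlgebraHom (yjm i) (cFill f) = (2 * ((f.symm i).res : ℂ)) • cFill f := by
  obtain ⟨i, hi⟩ := i
  induction i generalizing f with
  | zero =>
    have h0 : yjm (⟨0, hi⟩ : Fin n) = 0 := by
      rw [yjm, Finset.sum_eq_zero]
      intro k hk
      simp [Fin.lt_def] at hk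
    have h1 : (f.symm ⟨0, hi⟩).res = 0 := by
      have h2 : ∀ q : Cell l m, f q = ⟨0, hi⟩ → q.res = 0 := by
        rintro ⟨⟨b, r, s⟩, hq⟩ h
        have hz : (0, 0) ∈ (bif b then m else l) := mem_cell hq (Nat.zero_le _) (Nat.zero_le _)
        have h3 := hf.mono (p := ⟨(b, 0, 0), hz⟩) (q := ⟨(b, r, s), hq⟩) rfl (Nat.zero_le _)
          (Nat.zero_le _)
        have h4 : f ⟨(b, 0, 0), hz⟩ = f ⟨(b, r, s), hq⟩ := by
          refine le_antisymm h3 ?_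
          rw [h, Fin.le_def]
          exact Nat.zero_le _
        rw [← f.injective h4]
        simp [Cell.res, Cell.row, Cell.col]
      exact h2 _ (f.apply_symm_apply _)
    rw [h0, h1]
    simp
  | succ i ih =>
    have hi' : i < n := by omega
    have hab : (⟨i, hi'⟩ : Fin n).val + 1 = (⟨i + 1, hi⟩ : Fin n).val := rfl
    generalize hb : (⟨i + 1, hi⟩ : Fin n) = b at *
    have ih' := fun g hg => ih g hg hi'
    clear ih
    generalize ha : (⟨i, hi'⟩ : Fin n) = a at *
    have s2 : ∀ v, (rhoB n l m).asAlgebraHom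
        (MonoidAlgebra.of ℂ _ (BGroup.ofPerm (swap a b))) v = adjOp n l m a b v := by
      intro v
      rw [Representation.asAlgebraHom_of, rhoB_ofPerm, permRep_swap a b hab]
    have s3 : ∀ v, (rhoB n l m).asAlgebraHom
        (MonoidAlgebra.of ℂ _ (BGroup.t a * BGroup.t b * BGroup.ofPerm (swap a b))) v =
          rhoB n l m (BGroup.t a) (rhoB n l m (BGroup.t b) (adjOp n l m a b v)) := by
      intro v
      rw [Representation.asAlgebraHom_of, map_mul, map_mul, rhoB_ofPerm, permRep_swap a b hab]
      rfl
    have hor := isStandard_or hf hab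
    set g := f.trans (swap a b) with hg
    have ga : g.symm a = f.symm b := by simp [hg]
    have gb : g.symm b = f.symm a := by simp [hg]
    have gg : g.trans (swap a b) = f := by ext p; simp [hg]
    have cg : coef a b g = - coef a b f := by
      rw [hg, coef_trans, swap_apply_left, swap_apply_right, coef_swap]
    have og : offCoef a b g = offCoef a b f := by rw [offCoef, cg, neg_sq, offCoef]
    have hX : ((offCoef a b f : ℝ) : ℂ) • (rhoB n l m).asAlgebraHom (yjm a) (cFill g) =
        ((offCoef a b f : ℝ) : ℂ) • (2 * ((f.symm b).res : ℂ)) • cFill g := by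
      rcases hor with h | h
      · rw [ih' g h, ga]
      · rw [h]; simp
    have hs := smul_adjOp_cFill hor a b
    rw [gg, cg, og] at hs
    have q1 : ((offCoef a b f : ℝ) : ℂ) * ((offCoef a b f : ℝ) : ℂ) =
        1 - ((coef a b f : ℝ) : ℂ) ^ 2 := by
      exact_mod_cast offCoef_sq a b f
    rw [yjm_succ a b hab, map_add, map_add, map_mul, map_mul, LinearMap.add_apply,
      LinearMap.add_apply, Module.End.mul_apply, Module.End.mul_apply, s2, s2, s3,
      adjOp_cFill hf]
    simp only [map_add, map_smul, rhoB_t_cFill]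
    simp only [← hg]
    rw [← map_smul (adjOp n l m a b) ((offCoef a b f : ℝ) : ℂ), hX, ih' f hf]
    simp only [map_smul]
    rw [smul_comm _ (2 * ((f.symm b).res : ℂ)) (adjOp n l m a b (cFill g)), hs, adjOp_cFill hf,
      ga, gb]
    by_cases hc : (f.symm a).comp = (f.symm b).comp
    · have hne := res_ne hf (a := a) (b := b) (by rw [Fin.lt_def]; omega) (by omega) hc
      have hd : ((coef a b f : ℝ) : ℂ) * (((f.symm b).res : ℂ) - ((f.symm a).res : ℂ)) = 1 := by
        have h' : (((f.symm b).res : ℂ) - ((f.symm a).res : ℂ)) ≠ 0 := by exact_mod_cast hne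
        unfold coef
        rw [if_pos hc]
        push_cast
        exact inv_mul_cancel₀ h'
      push_cast
      rw [hc]
      cases (f.symm b).comp
      all_goals
        simp only [if_true, Bool.false_eq_true, if_false]
        match_scalars
        · linear_combination 2 * ((f.symm b).res : ℂ) * q1 - 2 * ((coef a b f : ℝ) : ℂ) * hd
        · linear_combination (-2) * ((offCoef a b f : ℝ) : ℂ) * hd
    · have h0 : coef a b f = 0 := if_neg hc
      rw [h0] at q1 ⊢
      push_cast
      generalize (f.symm a).comp = x at *
      generalize (f.symm b).comp = y at *
      cases x <;> cases y
      all_goals first | exact absurd rfl hc | skip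
      all_goals
        simp only [if_true, Bool.false_eq_true, if_false]
        match_scalars
        · push_cast at q1
          linear_combination 2 * ((f.symm b).res : ℂ) * q1
        · ring

/-- The restriction to `𝓓_n`, giving the module `S^{{l,m}}`. -/
def rhoD (n : ℕ) (l m : YoungDiagram) : Representation ℂ (DGroup n) (S n l m) :=
  (rhoB n l m).comp (DGroup n).subtype

/-! ## Intertwiners and bilinear forms -/

/-- `φ_{ε'} : S^{(l,m)} → S^{(m,l)}`, `c_T ↦ c_{T^♮}`. -/
def phi' (n : ℕ) (l m : YoungDiagram) : S n l m →ₗ[ℂ] S n m l :=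
  (c n l m).constr ℂ fun T => c n m l T.natural

/-- `φ_{ε''} : S^{(l,m)} → S^{(l*,m*)}`, `c_T ↦ (-1)^{ℓ(T)} c_{T*}`. -/
def phi'' (n : ℕ) (l m : YoungDiagram) : S n l m →ₗ[ℂ] S n l.transpose m.transpose :=
  (c n l m).constr ℂ fun T => T.lengthSign • c n l.transpose m.transpose T.transpose

/-- `φ_ε = φ_{ε''} ∘ φ_{ε'} : S^{(l,m)} → S^{(m*,l*)}`. -/
def phiEps (n : ℕ) (l m : YoungDiagram) : S n l m →ₗ[ℂ] S n m.transpose l.transpose :=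
  phi'' n m l ∘ₗ phi' n l m

/-- The identification `S^{(l,m)} = S^{(l',m')}` for `l = l'` and `m = m'`. -/
def congrS {l m l' m' : YoungDiagram} (hl : l = l') (hm : m = m') :
    S n l m →ₗ[ℂ] S n l' m' :=
  (c n l m).constr ℂ fun T => c n l' m' (T.congrShape hl hm)

/-- The bilinear form `⟨-,-⟩` on `S^{(l,m)}` for which the `c_T` form an orthonormal basis. -/
def innerForm (n : ℕ) (l m : YoungDiagram) : LinearMap.BilinForm ℂ (S n l m) :=
  LinearMap.mk₂ ℂ (fun u v => ∑ T, u T * v T)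
    (fun u u' v => by simp [add_mul, Finset.sum_add_distrib])
    (fun k u v => by simp [Finset.mul_sum, mul_assoc])
    (fun u v v' => by simp [mul_add, Finset.sum_add_distrib])
    (fun k u v => by simp [Finset.mul_sum, mul_left_comm])

/-- The form `(u|v) = ⟨u, φ_ε(v)⟩` on `S^{(l,m)}`, where `(l,m) = (m*,l*)`. -/
def formB (n : ℕ) (l m : YoungDiagram) (hl : m.transpose = l) (hm : l.transpose = m) :
    LinearMap.BilinForm ℂ (S n l m) :=
  (innerForm n l m).compl₂ (congrS hl hm ∘ₗ phiEps n l m)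

/-- The form `(u|v) = ⟨u, φ_{ε''}(v)⟩` on `S^{{l,m}}`, where `(l,m) = (l*,m*)`. -/
def formD (n : ℕ) (l m : YoungDiagram) (hl : l.transpose = l) (hm : m.transpose = m) :
    LinearMap.BilinForm ℂ (S n l m) :=
  (innerForm n l m).compl₂ (congrS hl hm ∘ₗ phi'' n l m)

/-- `S^{{l,+}}` (`s = 1`) and `S^{{l,-}}` (`s = -1`): the span of the `c_T ± c_{T^♮}`. -/
def SPM (n : ℕ) (l : YoungDiagram) (s : ℤˣ) : Submodule ℂ (S n l l) :=
  Submodule.span ℂ (Set.range fun T : StdBitableau n l l =>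
    c n l l T + ((s : ℤ) : ℂ) • c n l l T.natural)

theorem phi'_cFill (f : Cell l m ≃ Fin n) (hf : IsStandard f) :
    phi' n l m (cFill f) = cFill ((Cell.swapEquiv l m).symm.trans f) := by
  have h1 : cFill f = c n l m ⟨f, hf⟩ := dif_pos hf
  have h2 : cFill ((Cell.swapEquiv l m).symm.trans f) = c n m l (StdBitableau.natural ⟨f, hf⟩) :=
    dif_pos (StdBitableau.natural ⟨f, hf⟩).standard
  rw [h1, h2, phi', Module.Basis.constr_basis]

theorem hom_ext {V : Type*} [AddCommGroup V] [Module ℂ V] {A B : S n l m →ₗ[ℂ] V}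
    (h : ∀ f : Cell l m ≃ Fin n, IsStandard f → A (cFill f) = B (cFill f)) : A = B := by
  refine (c n l m).ext fun T => ?_
  have : cFill T.filling = c n l m T := dif_pos T.standard
  rw [← this]
  exact h T.filling T.standard

theorem phi'_adjOp (a b : Fin n) (hab : a.val + 1 = b.val) :
    phi' n l m ∘ₗ adjOp n l m a b = adjOp n m l a b ∘ₗ phi' n l m := by
  refine hom_ext fun f hf => ?_
  have hf' : IsStandard ((Cell.swapEquiv l m).symm.trans f) :=
    (StdBitableau.natural ⟨f, hf⟩).standard
  have hc : coef a b ((Cell.swapEquiv l m).symm.trans f) = coef a b f := by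
    have h1 : ∀ i, (((Cell.swapEquiv l m).symm.trans f).symm i).comp = !(f.symm i).comp :=
      fun _ => rfl
    have h2 : ∀ i, (((Cell.swapEquiv l m).symm.trans f).symm i).res = (f.symm i).res :=
      fun _ => rfl
    unfold coef
    simp only [h1, h2, Bool.not_inj_iff]
  rw [LinearMap.comp_apply, LinearMap.comp_apply, adjOp_cFill hf, phi'_cFill f hf,
    adjOp_cFill hf', map_add, map_smul, map_smul, phi'_cFill f hf, offCoef, offCoef, hc]
  rcases isStandard_or hf hab with h | h
  · rw [phi'_cFill _ h, Equiv.trans_assoc]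
  · rw [offCoef] at h
    rw [h]
    simp

theorem phi'_permRep (σ : Perm (Fin n)) :
    phi' n l m ∘ₗ permRep n l m σ = permRep n m l σ ∘ₗ phi' n l m := by
  refine adj_induction (p := fun σ =>
    phi' n l m ∘ₗ permRep n l m σ = permRep n m l σ ∘ₗ phi' n l m) ?_ ?_ σ
  · rw [map_one, map_one]; rfl
  · intro τ a b hab ih
    rw [map_mul, map_mul, permRep_swap a b hab, permRep_swap a b hab, Module.End.mul_eq_comp,
      Module.End.mul_eq_comp, ← LinearMap.comp_assoc, ih, LinearMap.comp_assoc,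
      phi'_adjOp a b hab, LinearMap.comp_assoc]

theorem phi'_signOp (x : Fin n → ℤˣ) :
    phi' n l m ∘ₗ signOp n l m x =
      (((∏ i, x i : ℤˣ) : ℤ) : ℂ) • (signOp n m l x ∘ₗ phi' n l m) := by
  refine hom_ext fun f hf => ?_
  rw [LinearMap.comp_apply, LinearMap.smul_apply, LinearMap.comp_apply, signOp_cFill, map_smul,
    phi'_cFill f hf, signOp_cFill, smul_smul]
  congr 1
  unfold weightChar
  push_cast
  rw [← Finset.prod_mul_distrib]
  refine Finset.prod_congr rfl fun i _ => ?_
  have h1 : (((Cell.swapEquiv l m).symm.trans f).symm i).comp = !(f.symm i).comp := rfl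
  rw [h1]
  rcases Int.units_eq_one_or (x i) with hx | hx <;> rw [hx] <;>
    cases (f.symm i).comp <;> simp

theorem phi'_rhoB (g : BGroup n) (v : S n l m) :
    phi' n l m (rhoB n l m g v) =
      (((BGroup.epsilon' n g : ℤˣ) : ℤ) : ℂ) • rhoB n m l g (phi' n l m v) := by
  have h1 := LinearMap.congr_fun (phi'_signOp (l := l) (m := m) g.left)
    (permRep n l m g.right v)
  have h2 := LinearMap.congr_fun (phi'_permRep (l := l) (m := m) g.right) v
  simp only [LinearMap.comp_apply, LinearMap.smul_apply] at h1 h2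
  change phi' n l m (signOp n l m g.left (permRep n l m g.right v)) = _
  rw [h1, h2]
  rfl

theorem mem_SPM (l : YoungDiagram) (s : ℤˣ) (w : S n l l) :
    w + ((s : ℤ) : ℂ) • phi' n l l w ∈ SPM n l s := by
  have h : ∀ T, c n l l T + ((s : ℤ) : ℂ) • phi' n l l (c n l l T) ∈ SPM n l s := by
    intro T
    rw [phi', Module.Basis.constr_basis]
    exact Submodule.subset_span ⟨T, rfl⟩
  rw [← (c n l l).sum_repr w, map_sum, Finset.smul_sum, ← Finset.sum_add_distrib]
  refine Submodule.sum_mem _ fun T _ => ?_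
  rw [map_smul, smul_comm, ← smul_add]
  exact Submodule.smul_mem _ _ (h T)

theorem SPM_le_comap (l : YoungDiagram) (s : ℤˣ) (g : DGroup n) :
    SPM n l s ≤ (SPM n l s).comap (rhoD n l l g) := by
  rw [SPM, Submodule.span_le]
  rintro _ ⟨T, rfl⟩
  have hg : BGroup.epsilon' n g.1 = 1 := g.2
  have h1 : phi' n l l (c n l l T) = c n l l T.natural := by
    rw [phi', Module.Basis.constr_basis]
  have h2 := phi'_rhoB g.1 (c n l l T)
  rw [hg, h1] at h2
  simp only [Units.val_one, Int.cast_one, one_smul] at h2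
  change rhoB n l l g.1 (c n l l T + ((s : ℤ) : ℂ) • c n l l T.natural) ∈ SPM n l s
  rw [map_add, map_smul, ← h2]
  exact mem_SPM l s _

/-- The representation of `𝓓_n` on `S^{{l,±}}`. -/
def rhoPM (n : ℕ) (l : YoungDiagram) (s : ℤˣ) : Representation ℂ (DGroup n) (SPM n l s) :=
  (rhoD n l l).subrepresentation (SPM n l s) (SPM_le_comap l s)

/-- The restriction of the form `⟨u, φ_{ε''}(v)⟩` to `S^{{l,±}}`, where `l = l*`. -/
def formPM (n : ℕ) (l : YoungDiagram) (hl : l.transpose = l) (s : ℤˣ) :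
    LinearMap.BilinForm ℂ (SPM n l s) :=
  (formD n l l hl hl).restrict (SPM n l s)

/-! ## Lie algebras generated by reflections -/

/-- The Lie algebra `𝔟_n ⊆ Lie(ℂ𝓑_n)` generated by the reflections. -/
def bLie (n : ℕ) : LieSubalgebra ℂ (MonoidAlgebra ℂ (BGroup n)) :=
  LieSubalgebra.lieSpan ℂ _ (MonoidAlgebra.of ℂ (BGroup n) '' bReflections n)

/-- The Lie algebra `𝔡_n ⊆ Lie(ℂ𝓓_n)` generated by the reflections. -/
def dLie (n : ℕ) : LieSubalgebra ℂ (MonoidAlgebra ℂ (DGroup n)) :=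
  LieSubalgebra.lieSpan ℂ _
    (MonoidAlgebra.of ℂ (DGroup n) '' {g : DGroup n | (g : BGroup n) ∈ dReflections n})

/-- The derived subalgebra `𝔤' = [𝔤, 𝔤]` of a Lie subalgebra `𝔤` of `L`, as a subalgebra of `L`. -/
def derivedSub {L : Type*} [LieRing L] [LieAlgebra ℂ L] (g : LieSubalgebra ℂ L) :
    LieSubalgebra ℂ L :=
  (LieIdeal.toLieSubalgebra ℂ g (LieAlgebra.derivedSeries ℂ g 1)).map g.incl

/-- The image of a Lie subalgebra of `Lie(ℂG)` under the structure map `ℂG → End(V)`. -/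
def imageSub {G V : Type*} [Group G] [AddCommGroup V] [Module ℂ V] (ρ : Representation ℂ G V)
    (g : LieSubalgebra ℂ (MonoidAlgebra ℂ G)) : LieSubalgebra ℂ (Module.End ℂ V) :=
  g.map (AlgHom.toLieHom ρ.asAlgebraHom)

/-- `𝔟_{(l,m)} = ρ_{(l,m)}(𝔟_n')`. -/
def bImage (n : ℕ) (l m : YoungDiagram) : LieSubalgebra ℂ (Module.End ℂ (S n l m)) :=
  imageSub (rhoB n l m) (derivedSub (bLie n))

/-- `𝔡_{{l,m}} = ρ_{{l,m}}(𝔡_n')`. -/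
def dImage (n : ℕ) (l m : YoungDiagram) : LieSubalgebra ℂ (Module.End ℂ (S n l m)) :=
  imageSub (rhoD n l m) (derivedSub (dLie n))

/-- `𝔡_{{l,±}} = ρ_{{l,±}}(𝔡_n')`. -/
def dImagePM (n : ℕ) (l : YoungDiagram) (s : ℤˣ) :
    LieSubalgebra ℂ (Module.End ℂ (SPM n l s)) :=
  imageSub (rhoPM n l s) (derivedSub (dLie n))

section Forms

variable {V : Type*} [AddCommGroup V] [Module ℂ V]

/-- `𝔬𝔰𝔭(V, B)`: all `x ∈ 𝔤𝔩(V)` with `B(x u, v) + B(u, x v) = 0` for all `u`, `v`. -/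
def osp (B : LinearMap.BilinForm ℂ V) : LieSubalgebra ℂ (Module.End ℂ V) where
  carrier := {x | ∀ u v, B (x u) v + B u (x v) = 0}
  zero_mem' := by simp
  add_mem' := by
    intro x y hx hy u v
    simp only [LinearMap.add_apply, map_add]
    linear_combination hx u v + hy u v
  smul_mem' := by
    intro k x hx u v
    simp only [LinearMap.smul_apply, map_smul, smul_eq_mul]
    linear_combination k * hx u v
  lie_mem' := by
    intro x y hx hy u v
    simp only [LieRing.of_associative_ring_bracket, LinearMap.sub_apply, Module.End.mul_apply,
      map_sub]
    linear_combination hx (y u) v - hy (x u) v + hx u (y v) - hy u (x v)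

/-- Symmetric bilinear forms. -/
def IsSymmForm (B : LinearMap.BilinForm ℂ V) : Prop := ∀ u v, B u v = B v u

/-- Anti-symmetric bilinear forms. -/
def IsAntisymmForm (B : LinearMap.BilinForm ℂ V) : Prop := ∀ u v, B u v = -B v u

/-- `g ⊆ 𝔰𝔬(V)` with respect to `B`: the form `B` is nondegenerate and symmetric, and `g` consists of
endomorphisms that are skew for `B`. -/
def LeSO (g : LieSubalgebra ℂ (Module.End ℂ V)) (B : LinearMap.BilinForm ℂ V) : Prop :=
  B.Nondegenerate ∧ IsSymmForm B ∧ g ≤ osp B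

/-- `g ⊆ 𝔰𝔭(V)` with respect to `B`: the form `B` is nondegenerate and anti-symmetric, and `g`
consists of endomorphisms that are skew for `B`. -/
def LeSP (g : LieSubalgebra ℂ (Module.End ℂ V)) (B : LinearMap.BilinForm ℂ V) : Prop :=
  B.Nondegenerate ∧ IsAntisymmForm B ∧ g ≤ osp B

end Forms

/-- The length `b(l)` of the diagonal of a Young diagram. -/
def diagLength (l : YoungDiagram) : ℕ := (l.cells.filter fun p => p.1 = p.2).card

end WeylLie

end

open WeylLie

noncomputable section

namespace WeylLie

open Equiv

variable {n : ℕ} {l m : YoungDiagram}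

/-! ## Generated Lie algebras and invariant forms -/

section Lie

/-! The form `⟨-,-⟩` is invariant under `𝓑_n`: the adjacent transpositions act by symmetric matrices
with square `1`, the sign changes by diagonal matrices with entries `±1`. The maps `φ_{ε'}` and
`φ_{ε''}` intertwine the action up to the characters `ε'` and `ε''` (the sign of the permutation
part), so `φ_ε` does so up to `ε = ε' ε''` (`phiEps_rhoB`).

Every reflection `r` of type B has `ε(r) = -1`, and every reflection of type D has `ε''(r) = -1`. So
the map `Φ` that defines the form anticommutes with `r`. As `r` is an orthogonal involution, `⟨r u,
Φ v⟩ = ⟨u, r Φ v⟩ = -⟨u, Φ r v⟩`, which says that `r` itself is skew (`skew_of_anticommute`). Skew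
endomorphisms form a Lie algebra, so it contains the image of everything that the reflections
generate, and in particular of the derived algebra.

In coordinates the forms are `B(u, v) = ∑ w_T u_{τT} v_T` with `τ` an involution of the bitableaux
and `w_T = ±1`. This gives nondegeneracy at once. Moreover `τT` arises from `T` by an involution `e`
of the boxes, so `w_{τT} = sgn(e) w_T` and the form is symmetric or anti-symmetric according to
`sgn(e)`. The number of 2-cycles of `e` is half the number of boxes that it moves: exchanging and
transposing moves all `n` boxes, transposing alone fixes exactly the diagonals.

For the halves of `S^{{l,l}}`, exchanging the two copies of `l` is a product of `|l|` disjoint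
transpositions of boxes. For `|l|` even, `φ_{ε'}` is thus an isometry of the form (`formD_phi'`).
The two halves lie in its `±1` eigenspaces, so testing a vector of one half against that half is as
good as testing it against the whole space. -/

theorem derivedSub_le {L : Type*} [LieRing L] [LieAlgebra ℂ L] (g : LieSubalgebra ℂ L) :
    derivedSub g ≤ g := by
  rintro _ ⟨y, -, rfl⟩
  exact y.2

/-- The derived series lives inside `g`, so `f` is first restricted to a homomorphism `F : g → g'`,
which carries derived ideals into derived ideals. -/
theorem map_mem_derivedSub {L L' : Type*} [LieRing L] [LieAlgebra ℂ L] [LieRing L']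
    [LieAlgebra ℂ L'] (f : L →ₗ⁅ℂ⁆ L') {g : LieSubalgebra ℂ L} {g' : LieSubalgebra ℂ L'}
    (h : ∀ x ∈ g, f x ∈ g') {x : L} (hx : x ∈ derivedSub g) : f x ∈ derivedSub g' := by
  obtain ⟨y, hy, rfl⟩ := hx
  let F : g →ₗ⁅ℂ⁆ g' :=
    { toFun := fun z => ⟨f z, h z z.2⟩
      map_add' := fun a b => Subtype.ext (map_add f (a : L) b)
      map_smul' := fun k a => Subtype.ext (map_smul f k (a : L))
      map_lie' := fun {a b} => Subtype.ext (LieHom.map_lie f (a : L) b) }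
  exact ⟨F y, LieIdeal.derivedSeries_map_le 1 (LieIdeal.mem_map hy), rfl⟩

variable {G V : Type*} [Group G] [AddCommGroup V] [Module ℂ V]

/-- The preimage of `osp B` is a Lie subalgebra, so checking generators suffices. The argument
bounds the image of the whole generated algebra; passing to the derived algebra only shrinks it. -/
theorem imageSub_derivedSub_lieSpan_le_osp (ρ : Representation ℂ G V)
    (B : LinearMap.BilinForm ℂ V) (R : Set G)
    (h : ∀ g ∈ R, ∀ u v, B (ρ g u) v + B u (ρ g v) = 0) :
    imageSub ρ (derivedSub (LieSubalgebra.lieSpan ℂ _ (MonoidAlgebra.of ℂ G '' R))) ≤ osp B := by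
  have key : LieSubalgebra.lieSpan ℂ _ (MonoidAlgebra.of ℂ G '' R) ≤
      (osp B).comap (AlgHom.toLieHom ρ.asAlgebraHom) := by
    rw [LieSubalgebra.lieSpan_le]
    rintro _ ⟨g, hg, rfl⟩
    change ∀ u v, B (ρ.asAlgebraHom (MonoidAlgebra.of ℂ G g) u) v +
      B u (ρ.asAlgebraHom (MonoidAlgebra.of ℂ G g) v) = 0
    rw [Representation.asAlgebraHom_of]
    exact h g hg
  rintro _ ⟨x, hx, rfl⟩
  exact key (derivedSub_le _ hx)

end Lie

/-- The inclusion `ι : ℂ𝓓_n → ℂ𝓑_n` takes reflections to reflections, hence `𝔡_n` into `𝔟_n` and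
`𝔡_n'` into `𝔟_n'`; and `rhoD` is `rhoB` composed with `ι`. -/
theorem dImage_le_bImage (n : ℕ) (l m : YoungDiagram) : dImage n l m ≤ bImage n l m := by
  rintro _ ⟨x, hx, rfl⟩
  let ι : MonoidAlgebra ℂ (DGroup n) →ₐ[ℂ] MonoidAlgebra ℂ (BGroup n) :=
    MonoidAlgebra.mapDomainAlgHom ℂ ℂ (DGroup n).subtype
  have hι : ∀ g : DGroup n, ι (MonoidAlgebra.of ℂ (DGroup n) g) =
      MonoidAlgebra.of ℂ (BGroup n) g := by
    intro g
    simp [ι]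
  have hρ : (rhoB n l m).asAlgebraHom.comp ι = (rhoD n l m).asAlgebraHom := by
    refine MonoidAlgebra.algHom_ext (fun g => ?_) (Subsingleton.elim _ _)
    change (rhoB n l m).asAlgebraHom (ι (MonoidAlgebra.of ℂ (DGroup n) g)) =
      (rhoD n l m).asAlgebraHom (MonoidAlgebra.of ℂ (DGroup n) g)
    rw [hι, Representation.asAlgebraHom_of, Representation.asAlgebraHom_of]
    rfl
  have hle : dLie n ≤ (bLie n).comap ι.toLieHom := by
    rw [dLie, LieSubalgebra.lieSpan_le]
    rintro _ ⟨g, hg, rfl⟩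
    change ι (MonoidAlgebra.of ℂ (DGroup n) g) ∈ bLie n
    rw [hι]
    exact LieSubalgebra.subset_lieSpan ⟨g, Or.inl hg, rfl⟩
  refine ⟨ι x, map_mem_derivedSub ι.toLieHom hle hx, ?_⟩
  exact AlgHom.congr_fun hρ x

/-! ## Bilinear forms given by weighted involutions of a basis -/

section WeightedForm

variable {ι : Type*} [Fintype ι] {B : LinearMap.BilinForm ℂ (ι → ℂ)} {w : ι → ℂ} {τ : ι → ι}

theorem nondegenerate_of_weighted_involution (hB : ∀ u v, B u v = ∑ i, w i * u (τ i) * v i)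
    (hw : ∀ i, w i ≠ 0) (hτ : Function.Involutive τ) : B.Nondegenerate := by
  classical
  constructor
  · intro u hu
    funext i
    -- Pairing `u` with the basis vector at `τ i` leaves `w (τ i) * u i`. In the other argument the
    -- same vector leaves `w i * v i`.
    have := hu (Pi.single (τ i) 1)
    rw [hB, Finset.sum_eq_single (τ i) (fun j _ hj => by simp [hj]) (by simp)] at this
    simpa [hw, hτ i] using this
  · intro v hv
    funext i
    have := hv (Pi.single (τ i) 1)
    rw [hB, Finset.sum_eq_single i (fun j _ hj => by simp [hτ.injective.ne hj]) (by simp)] at this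
    simpa [hw] using this

/-- Reindexing the sum by `τ` exchanges the roles of `u` and `v` and replaces `w i` by `w (τ i)`. -/
theorem weighted_involution_comm (hB : ∀ u v, B u v = ∑ i, w i * u (τ i) * v i)
    (hτ : Function.Involutive τ) {κ : ℂ} (hκ : ∀ i, w (τ i) = κ * w i) (u v : ι → ℂ) :
    B u v = κ * B v u := by
  rw [hB, hB, Finset.mul_sum, ← Equiv.sum_comp hτ.toPerm]
  refine Finset.sum_congr rfl fun i _ => ?_
  simp only [Function.Involutive.coe_toPerm, hκ, hτ i]
  ring

end WeightedForm

/-- An involution is a product of disjoint transpositions, one for each pair of points that it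
moves. -/
theorem sign_of_involutive {α : Type*} [Fintype α] [DecidableEq α] {e : Perm α}
    (he : Function.Involutive e) :
    Even (Nat.card α - Nat.card (Function.fixedPoints e)) ∧
      Perm.sign e = (-1) ^ ((Nat.card α - Nat.card (Function.fixedPoints e)) / 2) := by
  have h2 : e ^ 2 = 1 := by ext x; simp [pow_two, he x]
  have hc := Perm.card_fixedPoints e
  rw [Perm.sum_cycleType] at hc
  have hle := Finset.card_le_univ e.support
  rw [Nat.card_eq_fintype_card, Nat.card_eq_fintype_card]
  refine ⟨?_, Perm.sign_of_pow_two_eq_one h2⟩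
  rw [hc, Nat.sub_sub_self hle]
  exact even_iff_two_dvd.2 (Perm.two_dvd_card_support h2)

/-! ## Involutions of the set of boxes -/

namespace Cell

/-- The boxes of `(l, m)` are those of `l` together with those of `m`. -/
def equivSum (l m : YoungDiagram) : Cell l m ≃ l.cells ⊕ m.cells where
  toFun
    | ⟨(false, p), h⟩ => Sum.inl ⟨p, h⟩
    | ⟨(true, p), h⟩ => Sum.inr ⟨p, h⟩
  invFun
    | Sum.inl p => ⟨(false, p.1), p.2⟩
    | Sum.inr p => ⟨(true, p.1), p.2⟩
  left_inv := by rintro ⟨⟨_ | _, p⟩, h⟩ <;> rfl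
  right_inv := by rintro (⟨p, h⟩ | ⟨p, h⟩) <;> rfl

theorem nat_card (l m : YoungDiagram) : Nat.card (Cell l m) = l.card + m.card := by
  rw [Nat.card_congr (equivSum l m), Nat.card_sum]
  simp only [Nat.card_eq_fintype_card, Fintype.card_coe, YoungDiagram.card]

/-- Transposing both diagrams of a pair of self-conjugate diagrams. -/
def transposePerm (hl : l.transpose = l) (hm : m.transpose = m) : Perm (Cell l m) :=
  (transposeEquiv l m).trans (congrEquiv hl hm)

/-- Exchanging and transposing two diagrams that are conjugate to each other. -/
def swapTransposePerm (hl : m.transpose = l) (hm : l.transpose = m) : Perm (Cell l m) :=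
  (swapEquiv l m).trans ((transposeEquiv m l).trans (congrEquiv hl hm))

theorem transposePerm_involutive (hl : l.transpose = l) (hm : m.transpose = m) :
    Function.Involutive (transposePerm hl hm) := fun _ => rfl

theorem swapTransposePerm_involutive (hl : m.transpose = l) (hm : l.transpose = m) :
    Function.Involutive (swapTransposePerm hl hm) :=
  fun p => Subtype.ext (Prod.ext (Bool.not_not p.1.1) rfl)

theorem swapEquiv_involutive (l : YoungDiagram) : Function.Involutive (swapEquiv l l) :=
  fun p => Subtype.ext (Prod.ext (Bool.not_not p.1.1) rfl)

/-- Every box changes its component. -/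
theorem card_fixedPoints_swapTransposePerm (hl : m.transpose = l) (hm : l.transpose = m) :
    Nat.card (Function.fixedPoints (swapTransposePerm hl hm)) = 0 := by
  rw [Nat.card_eq_zero]
  refine Or.inl ⟨fun ⟨p, hp⟩ => ?_⟩
  exact Bool.not_ne_self p.1.1 (congrArg comp hp)

theorem card_fixedPoints_swapEquiv (l : YoungDiagram) :
    Nat.card (Function.fixedPoints (swapEquiv l l)) = 0 := by
  rw [Nat.card_eq_zero]
  refine Or.inl ⟨fun ⟨p, hp⟩ => ?_⟩
  exact Bool.not_ne_self p.1.1 (congrArg comp hp)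

theorem card_fixedPoints_transposePerm (hl : l.transpose = l) (hm : m.transpose = m) :
    Nat.card (Function.fixedPoints (transposePerm hl hm)) = diagLength l + diagLength m := by
  have h : ∀ p : Cell l m, transposePerm hl hm p = p ↔ p.row = p.col := fun p =>
    ⟨fun h => (congrArg col h), fun h => ext' rfl h.symm h⟩
  have e : Function.fixedPoints (transposePerm hl hm) ≃
      (l.cells.filter fun p => p.1 = p.2) ⊕ (m.cells.filter fun p => p.1 = p.2) :=
    { toFun := fun
        | ⟨⟨(false, p), hp⟩, hq⟩ => Sum.inl ⟨p, Finset.mem_filter.2 ⟨hp, (h _).1 hq⟩⟩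
        | ⟨⟨(true, p), hp⟩, hq⟩ => Sum.inr ⟨p, Finset.mem_filter.2 ⟨hp, (h _).1 hq⟩⟩
      invFun := fun
        | Sum.inl p => ⟨⟨(false, p.1), (Finset.mem_filter.1 p.2).1⟩,
            (h _).2 (Finset.mem_filter.1 p.2).2⟩
        | Sum.inr p => ⟨⟨(true, p.1), (Finset.mem_filter.1 p.2).1⟩,
            (h _).2 (Finset.mem_filter.1 p.2).2⟩
      left_inv := by rintro ⟨⟨⟨_ | _, p⟩, hp⟩, hq⟩ <;> rfl
      right_inv := by rintro (⟨p, hp⟩ | ⟨p, hp⟩) <;> rfl }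
  rw [Nat.card_congr e, Nat.card_sum]
  simp only [Nat.card_eq_fintype_card, Fintype.card_coe, diagLength]

end Cell

theorem diagLength_le_card (l : YoungDiagram) : diagLength l ≤ l.card :=
  Finset.card_filter_le _ _

/-! ## Signs of bitableaux -/

namespace StdBitableau

theorem lengthSign_ne_zero (T : StdBitableau n l m) : T.lengthSign ≠ 0 := by
  unfold lengthSign
  rcases Int.units_eq_one_or (Perm.sign T.perm) with h | h <;> simp [h]

/-- Both bitableaux have the same row major filling, since `rowMajor` uses its argument only in a
proof. Hence `σ_U = σ σ_T`. -/
theorem lengthSign_eq_of_trans {T U : StdBitableau n l m} (σ : Perm (Fin n))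
    (h : U.filling = T.filling.trans σ) :
    U.lengthSign = ((Perm.sign σ : ℤ) : ℂ) * T.lengthSign := by
  have h1 : U.perm = T.perm.trans σ := by
    change U.rowMajor.symm.trans U.filling = _
    rw [h]
    rfl
  rw [lengthSign, h1, Perm.sign_trans, lengthSign]
  push_cast
  ring

/-- Permuting boxes multiplies `σ_T` on the right by the conjugate of `e` under the row major
filling, and conjugation preserves the sign. -/
theorem lengthSign_eq_of_perm [Fintype (Cell l m)] {T U : StdBitableau n l m}
    (e : Perm (Cell l m)) (h : U.filling = e.trans T.filling) :
    U.lengthSign = ((Perm.sign e : ℤ) : ℂ) * T.lengthSign := by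
  have h1 : U.perm = ((T.rowMajor.symm.trans e).trans T.rowMajor).trans T.perm := by
    change U.rowMajor.symm.trans U.filling = _
    rw [h]
    ext i
    simp [perm]
    rfl
  rw [lengthSign, h1, Perm.sign_trans, Perm.sign_symm_trans_trans, lengthSign]
  push_cast
  ring

/-- The common source of all the parities: the factor is `sgn(e)`, which depends on the shape and
not on the bitableau. -/
theorem lengthSign_congr_involutive {T U : StdBitableau n l m} {e : Perm (Cell l m)}
    (he : Function.Involutive e) (h : U.filling = e.trans T.filling) {k : ℕ}
    (hk : Nat.card (Function.fixedPoints e) = k) :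
    U.lengthSign = (-1) ^ ((l.card + m.card - k) / 2) * T.lengthSign := by
  let := Fintype.ofFinite (Cell l m)
  rw [lengthSign_eq_of_perm e h, (sign_of_involutive he).2, hk, Cell.nat_card]
  push_cast
  rfl

/-- The involution `T ↦ T^*` for self-conjugate shapes. -/
def selfTranspose (hl : l.transpose = l) (hm : m.transpose = m) (T : StdBitableau n l m) :
    StdBitableau n l m :=
  T.transpose.congrShape hl hm

/-- The involution `T ↦ (T^♮)^*` for shapes `(l, m) = (m^*, l^*)`. -/
def naturalTranspose (hl : m.transpose = l) (hm : l.transpose = m) (T : StdBitableau n l m) :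
    StdBitableau n l m :=
  T.natural.transpose.congrShape hl hm

theorem selfTranspose_involutive (hl : l.transpose = l) (hm : m.transpose = m) :
    Function.Involutive (selfTranspose (n := n) hl hm) := fun _ => rfl

theorem natural_natural (T : StdBitableau n l m) : T.natural.natural = T :=
  StdBitableau.ext <| Equiv.ext fun p =>
    congrArg T.filling (Subtype.ext (Prod.ext (Bool.not_not p.1.1) rfl))

theorem naturalTranspose_involutive (hl : m.transpose = l) (hm : l.transpose = m) :
    Function.Involutive (naturalTranspose (n := n) hl hm) := fun T => by
  refine StdBitableau.ext <| Equiv.ext fun p =>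
    congrArg T.filling (Subtype.ext (Prod.ext (Bool.not_not p.1.1) rfl))

theorem lengthSign_selfTranspose (hl : l.transpose = l) (hm : m.transpose = m)
    (T : StdBitableau n l m) : (T.selfTranspose hl hm).lengthSign =
      (-1) ^ ((l.card + m.card - (diagLength l + diagLength m)) / 2) * T.lengthSign :=
  lengthSign_congr_involutive (Cell.transposePerm_involutive hl hm) rfl
    (Cell.card_fixedPoints_transposePerm hl hm)

/-- The signs are taken after `♮`, in shape `(m, l)`, because `φ_ε` applies `φ_{ε'}` first and reads
off `ℓ` only then. The box involution therefore acts on `Cell m l`. -/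
theorem lengthSign_natural_naturalTranspose (hl : m.transpose = l) (hm : l.transpose = m)
    (T : StdBitableau n l m) : (T.naturalTranspose hl hm).natural.lengthSign =
      (-1) ^ ((m.card + l.card) / 2) * T.natural.lengthSign :=
  lengthSign_congr_involutive (Cell.swapTransposePerm_involutive hm hl)
    (Equiv.ext fun _ => rfl) (Cell.card_fixedPoints_swapTransposePerm hm hl)

theorem lengthSign_natural (T : StdBitableau n l l) :
    T.natural.lengthSign = (-1) ^ ((l.card + l.card) / 2) * T.lengthSign :=
  lengthSign_congr_involutive (Cell.swapEquiv_involutive l)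
    (Equiv.ext fun _ => rfl) (Cell.card_fixedPoints_swapEquiv l)

end StdBitableau

/-! ## The twist by the sign of the permutation -/

theorem cFill_filling (T : StdBitableau n l m) : cFill T.filling = c n l m T :=
  dif_pos T.standard

theorem phi'_c (T : StdBitableau n l m) : phi' n l m (c n l m T) = c n m l T.natural :=
  Module.Basis.constr_basis ..

theorem phi''_c (T : StdBitableau n l m) :
    phi'' n l m (c n l m T) = T.lengthSign • c n l.transpose m.transpose T.transpose :=
  Module.Basis.constr_basis ..

theorem congrS_c {l' m' : YoungDiagram} (hl : l = l') (hm : m = m') (T : StdBitableau n l m) :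
    congrS hl hm (c n l m T) = c n l' m' (T.congrShape hl hm) :=
  Module.Basis.constr_basis ..

theorem phi''_cFill (T : StdBitableau n l m) :
    phi'' n l m (cFill T.filling) = T.lengthSign • cFill T.transpose.filling := by
  rw [cFill_filling, cFill_filling, phi''_c]

/-- Transposing negates residues, hence the diagonal coefficient `d`, and leaves `√(1 - d²)` alone.
The off-diagonal term gets its minus sign from `(-1)^{ℓ(sT)} = -(-1)^{ℓ(T)}`. -/
theorem phi''_adjOp (a b : Fin n) (hab : a.val + 1 = b.val) :
    phi'' n l m ∘ₗ adjOp n l m a b = -(adjOp n l.transpose m.transpose a b ∘ₗ phi'' n l m) := by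
  refine hom_ext fun f hf => ?_
  obtain ⟨T, rfl⟩ : ∃ T : StdBitableau n l m, T.filling = f := ⟨⟨f, hf⟩, rfl⟩
  have hne : a ≠ b := by rintro rfl; omega
  have hc : coef a b T.transpose.filling = -coef a b T.filling := by
    have h1 : ∀ i, (T.transpose.filling.symm i).comp = (T.filling.symm i).comp := fun _ => rfl
    have h2 : ∀ i, (T.transpose.filling.symm i).res = -(T.filling.symm i).res :=
      fun i => (neg_sub _ _).symm
    unfold coef
    simp only [h1, h2]
    split_ifs
    · rw [← inv_neg]
      push_cast
      congr 1
      ring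
    · simp
  have ho : offCoef a b T.transpose.filling = offCoef a b T.filling := by
    rw [offCoef, hc, neg_sq, offCoef]
  rw [LinearMap.comp_apply, LinearMap.neg_apply, LinearMap.comp_apply, adjOp_cFill hf, map_add,
    map_smul, map_smul, phi''_cFill T, map_smul, adjOp_cFill T.transpose.standard, ho, hc]
  rcases isStandard_or hf hab with h | h
  · have hs : (⟨_, h⟩ : StdBitableau n l m).lengthSign = -T.lengthSign := by
      rw [StdBitableau.lengthSign_eq_of_trans (T := T) (swap a b) rfl, Perm.sign_swap hne]
      simp
    have := phi''_cFill (⟨_, h⟩ : StdBitableau n l m)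
    rw [this, hs]
    -- Relabelling entries and transposing boxes commute definitionally: `s(T*) = (sT)*`.
    change _ = -(T.lengthSign • (_ + _ • cFill (StdBitableau.transpose ⟨_, h⟩).filling))
    push_cast
    module
  -- If `sT` is not standard, the coefficient of the second term vanishes on both sides.
  · rw [h]
    push_cast
    module

theorem phi''_permRep (σ : Perm (Fin n)) :
    phi'' n l m ∘ₗ permRep n l m σ = ((Perm.sign σ : ℤ) : ℂ) •
      (permRep n l.transpose m.transpose σ ∘ₗ phi'' n l m) := by
  refine adj_induction (p := fun σ => phi'' n l m ∘ₗ permRep n l m σ = ((Perm.sign σ : ℤ) : ℂ) •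
      (permRep n l.transpose m.transpose σ ∘ₗ phi'' n l m)) ?_ ?_ σ
  · rw [map_one, map_one, map_one]
    simp only [Units.val_one, Int.cast_one, one_smul]
    rfl
  · intro τ a b hab ih
    have hne : a ≠ b := by rintro rfl; omega
    rw [map_mul, map_mul, map_mul, permRep_swap a b hab, permRep_swap a b hab,
      Module.End.mul_eq_comp, Module.End.mul_eq_comp, ← LinearMap.comp_assoc, ih,
      LinearMap.smul_comp, LinearMap.comp_assoc, phi''_adjOp a b hab, LinearMap.comp_neg,
      LinearMap.comp_assoc, Perm.sign_swap hne, mul_neg_one, Units.val_neg, Int.cast_neg, smul_neg]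
    exact (neg_smul _ _).symm

/-- No twist occurs here: transposing keeps every entry in its component, and `weightChar` sees
nothing else. -/
theorem phi''_signOp (x : Fin n → ℤˣ) :
    phi'' n l m ∘ₗ signOp n l m x = signOp n l.transpose m.transpose x ∘ₗ phi'' n l m := by
  refine hom_ext fun f hf => ?_
  obtain ⟨T, rfl⟩ : ∃ T : StdBitableau n l m, T.filling = f := ⟨⟨f, hf⟩, rfl⟩
  rw [LinearMap.comp_apply, LinearMap.comp_apply, signOp_cFill, map_smul, phi''_cFill T, map_smul,
    signOp_cFill, smul_comm]
  rfl

theorem phi''_rhoB (g : BGroup n) (v : S n l m) :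
    phi'' n l m (rhoB n l m g v) = ((Perm.sign g.right : ℤ) : ℂ) •
      rhoB n l.transpose m.transpose g (phi'' n l m v) := by
  have h1 := LinearMap.congr_fun (phi''_signOp (l := l) (m := m) g.left)
    (permRep n l m g.right v)
  have h2 := LinearMap.congr_fun (phi''_permRep (l := l) (m := m) g.right) v
  simp only [LinearMap.comp_apply, LinearMap.smul_apply] at h1 h2
  change phi'' n l m (signOp n l m g.left (permRep n l m g.right v)) = _
  rw [h1, h2, map_smul]
  rfl

theorem phiEps_rhoB (g : BGroup n) (v : S n l m) :
    phiEps n l m (rhoB n l m g v) =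
      (((BGroup.epsilon' n g * Perm.sign g.right : ℤˣ) : ℤ) : ℂ) •
        rhoB n m.transpose l.transpose g (phiEps n l m v) := by
  rw [phiEps, LinearMap.comp_apply, phi'_rhoB, map_smul, phi''_rhoB, smul_smul]
  push_cast
  rfl

/-- Needed because the target shape of `φ_ε` or `φ_{ε''}` equals `(l, m)` only propositionally; once
the equalities are substituted, `congrS` is the identity. -/
theorem congrS_rhoB {l' m' : YoungDiagram} (hl : l = l') (hm : m = m') (g : BGroup n)
    (v : S n l m) : congrS hl hm (rhoB n l m g v) = rhoB n l' m' g (congrS hl hm v) := by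
  subst hl hm
  have : congrS (n := n) (rfl : l = l) (rfl : m = m) = LinearMap.id := by
    refine (c n l m).ext fun T => ?_
    rw [congrS_c]
    rfl
  rw [this]
  rfl

/-! ## Invariance of the forms -/

theorem innerForm_c_right (u : S n l m) (T : StdBitableau n l m) :
    innerForm n l m u (c n l m T) = u T := by
  change ∑ U, u U * c n l m T U = u T
  rw [Finset.sum_eq_single T (fun U _ hU => by simp [hU]) (by simp)]
  simp

/-- Orthonormality extended to all fillings, with `cFill` zero off the standard ones, so that the
term `c_{sT}` can be treated without case distinctions. -/
theorem innerForm_cFill (f g : Cell l m ≃ Fin n) [Decidable (IsStandard f ∧ f = g)] :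
    innerForm n l m (cFill f) (cFill g) = if IsStandard f ∧ f = g then 1 else 0 := by
  by_cases hg : IsStandard g
  · have h1 : cFill g = c n l m ⟨g, hg⟩ := dif_pos hg
    rw [h1, innerForm_c_right]
    by_cases hf : IsStandard f
    · have h2 : cFill f = c n l m ⟨f, hf⟩ := dif_pos hf
      rw [h2]
      by_cases h : f = g
      · subst h
        simp [hf]
      · have hne : (⟨g, hg⟩ : StdBitableau n l m) ≠ ⟨f, hf⟩ :=
          fun e => h (congrArg StdBitableau.filling e).symm
        simp [h, hne]
    · have h2 : cFill f = (0 : S n l m) := dif_neg hf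
      rw [h2, if_neg fun h => hf h.1]
      rfl
  · have h1 : cFill g = (0 : S n l m) := dif_neg hg
    rw [h1, map_zero, if_neg]
    rintro ⟨h, rfl⟩
    exact hg h

theorem bilin_ext {A B : LinearMap.BilinForm ℂ (S n l m)}
    (h : ∀ f g : Cell l m ≃ Fin n, IsStandard f → IsStandard g →
      A (cFill f) (cFill g) = B (cFill f) (cFill g)) : A = B :=
  hom_ext fun f hf => hom_ext fun g hg => h f g hf hg

/-- The matrix is symmetric: the entries linking `T` and `sT` are `√(1 - d²)` and `√(1 - (-d)²)`. -/
theorem innerForm_adjOp (a b : Fin n) (u v : S n l m) :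
    innerForm n l m (adjOp n l m a b u) v = innerForm n l m u (adjOp n l m a b v) := by
  classical
  suffices (innerForm n l m).compl₁₂ (adjOp n l m a b) LinearMap.id =
      (innerForm n l m).compl₁₂ LinearMap.id (adjOp n l m a b) from
    LinearMap.congr_fun₂ this u v
  refine bilin_ext fun f g hf hg => ?_
  have hst : ∀ f : Cell l m ≃ Fin n, (f.trans (swap a b)).trans (swap a b) = f :=
    fun f => by ext; simp
  simp only [LinearMap.compl₁₂_apply, LinearMap.id_apply, adjOp_cFill hf, adjOp_cFill hg, map_add,
    map_smul, LinearMap.add_apply, LinearMap.smul_apply, innerForm_cFill, smul_eq_mul]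
  by_cases h : f.trans (swap a b) = g
  · subst h
    have h0 : coef a b (f.trans (swap a b)) = -coef a b f := by
      rw [coef_trans, swap_apply_left, swap_apply_right, coef_swap]
    have ho : offCoef a b (f.trans (swap a b)) = offCoef a b f := by
      rw [offCoef, h0, neg_sq, offCoef]
    simp only [hst, ho, hf, hg, and_self, if_true]
    -- The case `a = b` is allowed, and then the filling and its swap coincide.
    by_cases hff : f = f.trans (swap a b)
    · rw [show coef a b (f.trans (swap a b)) = coef a b f by rw [← hff]]
    · simp [hff]
  · have h' : f ≠ g.trans (swap a b) := by
      rintro rfl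
      exact h (hst g)
    simp only [h, h', and_false, if_false]
    by_cases hfg : f = g
    · rw [hfg]
    · simp [hfg]

/-- A self-adjoint involution is orthogonal, and the adjacent transpositions generate. -/
theorem innerForm_permRep (σ : Perm (Fin n)) (u v : S n l m) :
    innerForm n l m (permRep n l m σ u) (permRep n l m σ v) = innerForm n l m u v := by
  revert u v
  refine adj_induction (p := fun σ => ∀ u v : S n l m,
    innerForm n l m (permRep n l m σ u) (permRep n l m σ v) = innerForm n l m u v) ?_ ?_ σ
  · intro u v
    rw [map_one]
    rfl
  · intro τ a b hab ih u v
    rw [map_mul, permRep_swap a b hab, Module.End.mul_apply, Module.End.mul_apply, ih,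
      innerForm_adjOp, ← Module.End.mul_apply, adjOp_sq a b hab]
    rfl

theorem innerForm_signOp (x : Fin n → ℤˣ) (u v : S n l m) :
    innerForm n l m (signOp n l m x u) (signOp n l m x v) = innerForm n l m u v := by
  classical
  suffices (innerForm n l m).compl₁₂ (signOp n l m x) (signOp n l m x) = innerForm n l m from
    LinearMap.congr_fun₂ this u v
  refine bilin_ext fun f g hf hg => ?_
  simp only [LinearMap.compl₁₂_apply, signOp_cFill, map_smul, LinearMap.smul_apply,
    innerForm_cFill, smul_eq_mul]
  by_cases hfg : f = g
  · subst hfg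
    have hx : x * x = 1 := funext fun i => Int.units_mul_self (x i)
    have := weightChar_mul x x f
    rw [hx] at this
    rw [← mul_assoc, ← this]
    simp [weightChar]
  · simp [hfg]

theorem innerForm_rhoB (g : BGroup n) (u v : S n l m) :
    innerForm n l m (rhoB n l m g u) (rhoB n l m g v) = innerForm n l m u v :=
  (innerForm_signOp g.left _ _).trans (innerForm_permRep g.right u v)

/-- Invariance together with `g² = 1` makes `g` self-adjoint for `⟨-,-⟩`. Moving it past `Φ` then
costs a sign, which is exactly skewness for `⟨-, Φ -⟩`. -/
theorem skew_of_anticommute {Φ : Module.End ℂ (S n l m)} {g : BGroup n} (hg : g * g = 1)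
    (hΦ : ∀ v, Φ (rhoB n l m g v) = -rhoB n l m g (Φ v)) (u v : S n l m) :
    (innerForm n l m).compl₂ Φ (rhoB n l m g u) v +
      (innerForm n l m).compl₂ Φ u (rhoB n l m g v) = 0 := by
  rw [LinearMap.compl₂_apply, LinearMap.compl₂_apply, hΦ, map_neg,
    ← innerForm_rhoB g (rhoB n l m g u), ← Module.End.mul_apply, ← map_mul, hg, map_one]
  exact add_neg_cancel _

/-! ## Reflections -/

theorem t_mul_self (i : Fin n) : BGroup.t i * BGroup.t i = 1 := by
  rw [BGroup.t, ← map_mul, ← Pi.mulSingle_mul]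
  simp

theorem epsilon'_t (i : Fin n) : BGroup.epsilon' n (BGroup.t i) = -1 := by
  change ∏ j, (Pi.mulSingle i (-1) : Fin n → ℤˣ) j = -1
  rw [Finset.prod_eq_single i (fun j _ hj => Pi.mulSingle_eq_of_ne hj _) (by simp),
    Pi.mulSingle_eq_same]

theorem epsilon'_ofPerm (σ : Perm (Fin n)) : BGroup.epsilon' n (BGroup.ofPerm σ) = 1 := by
  change ∏ j, (1 : Fin n → ℤˣ) j = 1
  simp

theorem t_comm (i j : Fin n) : BGroup.t i * BGroup.t j = BGroup.t j * BGroup.t i := by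
  rw [BGroup.t, BGroup.t, ← map_mul, ← map_mul, mul_comm]

theorem dReflections_spec {g : BGroup n} (hg : g ∈ dReflections n) :
    g * g = 1 ∧ BGroup.epsilon' n g = 1 ∧ Perm.sign g.right = -1 := by
  obtain ⟨i, j, hij, rfl | rfl⟩ := hg
  · refine ⟨?_, epsilon'_ofPerm _, Perm.sign_swap hij.ne⟩
    rw [← ofPerm_mul, swap_mul_self]
    rfl
  · refine ⟨?_, ?_, ?_⟩
    · have h : BGroup.ofPerm (swap i j) * (BGroup.t i * BGroup.t j) =
          BGroup.t i * BGroup.t j * BGroup.ofPerm (swap i j) := by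
        rw [← mul_assoc, ofPerm_conj_t, mul_assoc, ofPerm_conj_t, swap_apply_left,
          swap_apply_right, ← mul_assoc, t_comm]
      have h2 : BGroup.t i * BGroup.t j * (BGroup.t i * BGroup.t j) = 1 := by
        nth_rw 1 [t_comm i j]
        rw [mul_assoc, ← mul_assoc (BGroup.t i), t_mul_self, one_mul, t_mul_self]
      -- With `x = t_i t_j` and `p = (i,j)`, which commute, `(x p)² = x² p² = 1`.
      generalize BGroup.t i * BGroup.t j = x at h h2 ⊢
      rw [mul_assoc, ← mul_assoc (BGroup.ofPerm _), h, mul_assoc, ← mul_assoc, h2, one_mul,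
        ← ofPerm_mul, swap_mul_self]
      rfl
    · rw [map_mul, map_mul, epsilon'_t, epsilon'_t, epsilon'_ofPerm]
      rfl
    · change Perm.sign (1 * 1 * swap i j) = -1
      rw [one_mul, one_mul, Perm.sign_swap hij.ne]

/-- Exactly one of the two characters is `-1`: the sign of the permutation on the reflections of
type D, and `ε'` on the `t_i`. This is why type B needs the product `ε`. -/
theorem bReflections_spec {g : BGroup n} (hg : g ∈ bReflections n) :
    g * g = 1 ∧ BGroup.epsilon' n g * Perm.sign g.right = -1 := by
  rcases hg with hg | ⟨i, rfl⟩
  · obtain ⟨h1, h2, h3⟩ := dReflections_spec hg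
    exact ⟨h1, by rw [h2, h3, one_mul]⟩
  · refine ⟨t_mul_self i, ?_⟩
    rw [epsilon'_t]
    change -1 * Perm.sign 1 = -1
    rw [map_one, mul_one]

/-! ## The forms of type B and D -/

/-- Puts the form into the weighted-involution shape; both sides are linear in `v`, so they are
compared on the basis `c_T`. -/
theorem formB_apply (hl : m.transpose = l) (hm : l.transpose = m) (u v : S n l m) :
    formB n l m hl hm u v =
      ∑ T, T.natural.lengthSign * u (T.naturalTranspose hl hm) * v T := by
  suffices formB n l m hl hm u = ∑ T : StdBitableau n l m,
      (T.natural.lengthSign * u (T.naturalTranspose hl hm)) • LinearMap.proj T by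
    rw [this]
    simp
  refine (c n l m).ext fun T => ?_
  rw [formB, LinearMap.compl₂_apply, LinearMap.comp_apply, phiEps, LinearMap.comp_apply, phi'_c,
    phi''_c, map_smul, congrS_c, map_smul, innerForm_c_right, LinearMap.sum_apply,
    Finset.sum_eq_single T (fun U _ hU => by simp [hU]) (by simp)]
  simp [StdBitableau.naturalTranspose]

theorem formD_apply (hl : l.transpose = l) (hm : m.transpose = m) (u v : S n l m) :
    formD n l m hl hm u v = ∑ T, T.lengthSign * u (T.selfTranspose hl hm) * v T := by
  suffices formD n l m hl hm u = ∑ T : StdBitableau n l m,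
      (T.lengthSign * u (T.selfTranspose hl hm)) • LinearMap.proj T by
    rw [this]
    simp
  refine (c n l m).ext fun T => ?_
  rw [formD, LinearMap.compl₂_apply, LinearMap.comp_apply, phi''_c, map_smul, congrS_c, map_smul,
    innerForm_c_right, LinearMap.sum_apply,
    Finset.sum_eq_single T (fun U _ hU => by simp [hU]) (by simp)]
  simp [StdBitableau.selfTranspose]

theorem formB_nondegenerate (hl : m.transpose = l) (hm : l.transpose = m) :
    (formB n l m hl hm).Nondegenerate :=
  nondegenerate_of_weighted_involution (formB_apply hl hm)
    (fun T => T.natural.lengthSign_ne_zero) (StdBitableau.naturalTranspose_involutive hl hm)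

theorem formD_nondegenerate (hl : l.transpose = l) (hm : m.transpose = m) :
    (formD n l m hl hm).Nondegenerate :=
  nondegenerate_of_weighted_involution (formD_apply hl hm)
    (fun T => T.lengthSign_ne_zero) (StdBitableau.selfTranspose_involutive hl hm)

theorem formB_comm (hl : m.transpose = l) (hm : l.transpose = m) (u v : S n l m) :
    formB n l m hl hm u v = (-1) ^ ((m.card + l.card) / 2) * formB n l m hl hm v u :=
  weighted_involution_comm (formB_apply hl hm) (StdBitableau.naturalTranspose_involutive hl hm)
    (StdBitableau.lengthSign_natural_naturalTranspose hl hm) u v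

theorem formD_comm (hl : l.transpose = l) (hm : m.transpose = m) (u v : S n l m) :
    formD n l m hl hm u v = (-1) ^ ((l.card + m.card - (diagLength l + diagLength m)) / 2) *
      formD n l m hl hm v u :=
  weighted_involution_comm (formD_apply hl hm) (StdBitableau.selfTranspose_involutive hl hm)
    (StdBitableau.lengthSign_selfTranspose hl hm) u v

theorem formB_skew (hl : m.transpose = l) (hm : l.transpose = m) {g : BGroup n}
    (hg : g ∈ bReflections n) (u v : S n l m) :
    formB n l m hl hm (rhoB n l m g u) v + formB n l m hl hm u (rhoB n l m g v) = 0 := by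
  obtain ⟨h1, h2⟩ := bReflections_spec hg
  refine skew_of_anticommute h1 (fun v => ?_) u v
  rw [LinearMap.comp_apply, phiEps_rhoB, h2, map_smul, congrS_rhoB]
  simp

theorem formD_skew (hl : l.transpose = l) (hm : m.transpose = m) {g : BGroup n}
    (hg : g ∈ dReflections n) (u v : S n l m) :
    formD n l m hl hm (rhoB n l m g u) v + formD n l m hl hm u (rhoB n l m g v) = 0 := by
  obtain ⟨h1, -, h2⟩ := dReflections_spec hg
  refine skew_of_anticommute h1 (fun v => ?_) u v
  rw [LinearMap.comp_apply, phi''_rhoB, h2, map_smul, congrS_rhoB]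
  simp

theorem bImage_le_osp (hl : m.transpose = l) (hm : l.transpose = m) :
    bImage n l m ≤ osp (formB n l m hl hm) :=
  imageSub_derivedSub_lieSpan_le_osp _ _ _ fun _ hg => formB_skew hl hm hg

theorem dImage_le_osp (hl : l.transpose = l) (hm : m.transpose = m) :
    dImage n l m ≤ osp (formD n l m hl hm) :=
  imageSub_derivedSub_lieSpan_le_osp _ _ _ fun _ hg => formD_skew hl hm hg

theorem dImagePM_le_osp (hl : l.transpose = l) (s : ℤˣ) :
    dImagePM n l s ≤ osp (formPM n l hl s) :=
  imageSub_derivedSub_lieSpan_le_osp _ _ _ fun _ hg u v => formD_skew hl hl hg u.1 v.1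

/-! ## The two halves of `S^{{l,l}}` -/

theorem phi'_apply (u : S n l l) (T : StdBitableau n l l) : phi' n l l u T = u T.natural := by
  suffices LinearMap.proj T ∘ₗ phi' n l l = LinearMap.proj T.natural from
    LinearMap.congr_fun this u
  refine (c n l l).ext fun U => ?_
  rw [LinearMap.comp_apply, phi'_c]
  have : T = U.natural ↔ T.natural = U :=
    ⟨fun h => by rw [h, U.natural_natural], fun h => by rw [← h, T.natural_natural]⟩
  simp [Pi.single_apply, this]

/-- On a generator, `c_T + s c_{T^♮} ↦ c_{T^♮} + s c_T = s (c_T + s c_{T^♮})` because `s² = 1`. -/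
theorem phi'_of_mem_SPM {s : ℤˣ} {u : S n l l} (hu : u ∈ SPM n l s) :
    phi' n l l u = ((s : ℤ) : ℂ) • u := by
  suffices SPM n l s ≤ LinearMap.eqLocus (phi' n l l) (((s : ℤ) : ℂ) • LinearMap.id) from this hu
  rw [SPM, Submodule.span_le]
  rintro _ ⟨T, rfl⟩
  change phi' n l l _ = ((s : ℤ) : ℂ) • _
  rw [map_add, map_smul, phi'_c, phi'_c, T.natural_natural]
  rcases Int.units_eq_one_or s with rfl | rfl
  · simp [add_comm]
  · simp [add_comm]

/-- Evenness of `|l|` makes the weights invariant under `♮`, and `♮` commutes with transposing. -/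
theorem formD_phi' (hl : l.transpose = l) (he : Even l.card) (u v : S n l l) :
    formD n l l hl hl (phi' n l l u) (phi' n l l v) = formD n l l hl hl u v := by
  have hinv : Function.Involutive (StdBitableau.natural : StdBitableau n l l → _) :=
    StdBitableau.natural_natural
  have hs : ∀ T : StdBitableau n l l, T.natural.lengthSign = T.lengthSign := fun T => by
    rw [T.lengthSign_natural, ← two_mul, Nat.mul_div_cancel_left _ two_pos, he.neg_one_pow,
      one_mul]
  rw [formD_apply, formD_apply, ← Equiv.sum_comp hinv.toPerm]
  refine Finset.sum_congr rfl fun T _ => ?_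
  rw [Function.Involutive.coe_toPerm, phi'_apply, phi'_apply, T.natural_natural, hs]
  congr 3
  -- Uses that `(T^♮)^*` and `(T^*)^♮` agree definitionally.
  exact (T.selfTranspose hl hl).natural_natural

/-- For `u` in the half with sign `s`, the isometry `φ'` gives `s B(u, φ' v) = B(u, v)`, so pairing
`u` with the element `v + s φ' v` of that half yields `2 B(u, v)`. A vector orthogonal to its half
is orthogonal to the whole space. Left and right radicals are treated separately. -/
theorem formPM_nondegenerate (hl : l.transpose = l) (he : Even l.card) (s : ℤˣ) :
    (formPM n l hl s).Nondegenerate := by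
  have hproj : ∀ u ∈ SPM n l s, ∀ v, formD n l l hl hl u (v + ((s : ℤ) : ℂ) • phi' n l l v) =
      2 * formD n l l hl hl u v := fun u hu v => by
    have := formD_phi' hl he u v
    rw [phi'_of_mem_SPM hu, map_smul, LinearMap.smul_apply, smul_eq_mul] at this
    rw [map_add, map_smul, smul_eq_mul, this, two_mul]
  have hproj' : ∀ u ∈ SPM n l s, ∀ v, formD n l l hl hl (v + ((s : ℤ) : ℂ) • phi' n l l v) u =
      2 * formD n l l hl hl v u := fun u hu v => by
    have := formD_phi' hl he v u
    rw [phi'_of_mem_SPM hu, map_smul, smul_eq_mul] at this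
    rw [map_add, map_smul, LinearMap.add_apply, LinearMap.smul_apply, smul_eq_mul, this, two_mul]
  obtain ⟨hL, hR⟩ := formD_nondegenerate (n := n) hl hl
  constructor
  · intro u hu
    refine Subtype.ext (hL u fun v => ?_)
    have h := hu ⟨_, mem_SPM l s v⟩
    have h' := hproj u u.2 v
    change formD n l l hl hl u _ = 0 at h
    simpa using h'.symm.trans h
  · intro u hu
    refine Subtype.ext (hR u fun v => ?_)
    have h := hu ⟨_, mem_SPM l s v⟩
    have h' := hproj' u u.2 v
    change formD n l l hl hl _ u = 0 at h
    simpa using h'.symm.trans h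

/-! ### Parities of the exponents and the resulting symmetry of the forms. -/

theorem isSymmForm_of_comm {V : Type*} [AddCommGroup V] [Module ℂ V]
    {B : LinearMap.BilinForm ℂ V} {k : ℕ} (h : ∀ u v, B u v = (-1) ^ k * B v u) (hk : Even k) :
    IsSymmForm B := fun u v => by rw [h, hk.neg_one_pow, one_mul]

theorem isAntisymmForm_of_comm {V : Type*} [AddCommGroup V] [Module ℂ V]
    {B : LinearMap.BilinForm ℂ V} {k : ℕ} (h : ∀ u v, B u v = (-1) ^ k * B v u) (hk : Odd k) :
    IsAntisymmForm B := fun u v => by rw [h, hk.neg_one_pow, neg_one_mul]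

/-- The boxes off the diagonals are paired by transposition. -/
theorem even_card_sub_diagLength (hl : l.transpose = l) (hm : m.transpose = m) :
    Even (l.card + m.card - (diagLength l + diagLength m)) := by
  let := Fintype.ofFinite (Cell l m)
  have := (sign_of_involutive (Cell.transposePerm_involutive hl hm)).1
  rwa [Cell.nat_card, Cell.card_fixedPoints_transposePerm] at this

theorem card_transpose (l : YoungDiagram) : l.transpose.card = l.card :=
  Finset.card_map _

end WeylLie

end

/-! ### Assembly of the three cases. -/

theorem lemma4p11 (n : ℕ) :
    -- type B, `(l,m) = (m*,l*)`
    (∀ (l m : YoungDiagram) (_ : l.card + m.card = n) (hl : m.transpose = l) (hm : l.transpose = m),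
      (formB n l m hl hm).Nondegenerate ∧
      bImage n l m ≤ osp (formB n l m hl hm) ∧
      Even n ∧
      (Even (n / 2) → IsSymmForm (formB n l m hl hm)) ∧
      (Odd (n / 2) → IsAntisymmForm (formB n l m hl hm)) ∧
      (Even (n / 2) → LeSO (bImage n l m) (formB n l m hl hm)) ∧
      (Odd (n / 2) → LeSP (bImage n l m) (formB n l m hl hm)) ∧
      dImage n l m ≤ bImage n l m ∧
      dImage n l m ≤ osp (formB n l m hl hm)) ∧
    -- type D, `(l,m) = (l*,m*)`
    (∀ (l m : YoungDiagram) (_ : l.card + m.card = n) (hl : l.transpose = l) (hm : m.transpose = m),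
      (formD n l m hl hm).Nondegenerate ∧
      dImage n l m ≤ osp (formD n l m hl hm) ∧
      diagLength l + diagLength m ≤ n ∧
      Even (n - (diagLength l + diagLength m)) ∧
      (Even ((n - (diagLength l + diagLength m)) / 2) → IsSymmForm (formD n l m hl hm)) ∧
      (Odd ((n - (diagLength l + diagLength m)) / 2) → IsAntisymmForm (formD n l m hl hm)) ∧
      (Even ((n - (diagLength l + diagLength m)) / 2) →
        LeSO (dImage n l m) (formD n l m hl hm)) ∧
      (Odd ((n - (diagLength l + diagLength m)) / 2) →
        LeSP (dImage n l m) (formD n l m hl hm))) ∧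
    -- type D, the two halves of `S^{{l,l}}` for `l = l*` and `n/2` even
    (∀ (l : YoungDiagram) (_ : l.card + l.card = n) (hl : l.transpose = l) (_ : Even (n / 2))
      (s : ℤˣ),
      (formPM n l hl s).Nondegenerate ∧
      dImagePM n l s ≤ osp (formPM n l hl s) ∧
      (Even (diagLength l) → IsSymmForm (formPM n l hl s)) ∧
      (Odd (diagLength l) → IsAntisymmForm (formPM n l hl s)) ∧
      (Even (diagLength l) → LeSO (dImagePM n l s) (formPM n l hl s)) ∧
      (Odd (diagLength l) → LeSP (dImagePM n l s) (formPM n l hl s))) := by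
  refine ⟨fun l m hn hl hm => ?_, fun l m hn hl hm => ?_, fun l hn hl he s => ?_⟩
  -- Conjugate diagrams have equally many boxes, so `n = 2|l|` is even.
  · have hc : m.card = l.card := by rw [← hm, card_transpose]
    have hcomm := formB_comm (n := n) hl hm
    rw [add_comm, hn] at hcomm
    have hnd := formB_nondegenerate (n := n) hl hm
    have hb := bImage_le_osp (n := n) hl hm
    have hd := dImage_le_bImage n l m
    exact ⟨hnd, hb, ⟨l.card, by omega⟩, isSymmForm_of_comm hcomm, isAntisymmForm_of_comm hcomm,
      fun h => ⟨hnd, isSymmForm_of_comm hcomm h, hb⟩,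
      fun h => ⟨hnd, isAntisymmForm_of_comm hcomm h, hb⟩, hd, hd.trans hb⟩
  · have hcomm := formD_comm (n := n) hl hm
    have heven := even_card_sub_diagLength hl hm
    rw [hn] at hcomm heven
    have hnd := formD_nondegenerate (n := n) hl hm
    have hd := dImage_le_osp (n := n) hl hm
    have h1 := diagLength_le_card l
    have h2 := diagLength_le_card m
    exact ⟨hnd, hd, by omega, heven, isSymmForm_of_comm hcomm, isAntisymmForm_of_comm hcomm,
      fun h => ⟨hnd, isSymmForm_of_comm hcomm h, hd⟩,
      fun h => ⟨hnd, isAntisymmForm_of_comm hcomm h, hd⟩⟩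
  · have hl2 : n / 2 = l.card := by omega
    rw [hl2] at he
    have hle := diagLength_le_card l
    -- The exponent is `|l| - b(l)`, a genuine difference since `b(l) ≤ |l|`; with `|l| = n/2` even
    -- it has the parity of `b(l)`.
    have hpar : Even ((l.card + l.card - (diagLength l + diagLength l)) / 2) ↔
        Even (diagLength l) := by
      rw [show (l.card + l.card - (diagLength l + diagLength l)) / 2 = l.card - diagLength l by
        omega, Nat.even_sub hle]
      exact iff_true_left he
    have hcomm : ∀ u v, formPM n l hl s u v =
        (-1) ^ ((l.card + l.card - (diagLength l + diagLength l)) / 2) * formPM n l hl s v u :=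
      fun u v => formD_comm hl hl u.1 v.1
    have hsymm : Even (diagLength l) → IsSymmForm (formPM n l hl s) :=
      fun h => isSymmForm_of_comm hcomm (hpar.2 h)
    have hanti : Odd (diagLength l) → IsAntisymmForm (formPM n l hl s) := fun h =>
      isAntisymmForm_of_comm hcomm (Nat.not_even_iff_odd.1 fun h' =>
        Nat.not_even_iff_odd.2 h (hpar.1 h'))
    have hnd := formPM_nondegenerate (n := n) hl he s
    have hd := dImagePM_le_osp (n := n) hl s
    exact ⟨hnd, hd, hsymm, hanti, fun h => ⟨hnd, hsymm h, hd⟩, fun h => ⟨hnd, hanti h, hd⟩⟩
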